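/- **Setting.** Let $(\Omega,\mathcal F,\mathbb P)$ be a probability space, $d\in\mathbb N_0$, $\alpha,\beta>0$ and $\gamma\ge\alpha\wedge\beta$. *Lions forests.* A Lions forest is $T=(N,E,h_0,H,L)$ where $(N,E)$ is a finite directed forest (edges point from a node to its parent), $h_0\subseteq N$, $H$ is a partition of $N\setminus h_0$ into non-empty blocks, and $L:N\to\{1,\dots,d\}$. Write $x<y$ (resp. $x\lessgtr y$) when the path from $x$ to its root is shorter than (resp. as long as) that of $y$, and $H'=(H\cup\{h_0\})\setminus\{\emptyset\}$. It is required that: (i) if $h_0\neq\emptyset$, some $x\in h_0$ has minimal distance to its root among all nodes; (ii) if $h\in H'$, $x,y\in h$ and $x<y$, then the parent of $y$ exists and is in $h$; (iii) if $h\in H'$, $x_1,y_1\in h$, $x_1\lessgtr y_1$ and $(x_1,x_2),(y_1,y_2)\in E$ with $x_2\ne y_2$, then $x_2,y_2\in h$. The empty forest $\mathbf 1$ is included, and isomorphic forests are identified. Put $$T_1\circledast T_2=(N_1\sqcup N_2,\,E_1\sqcup E_2,\,h_0^1\sqcup h_0^2,\,H_1\sqcup H_2,\,L_1\sqcup L_2),\qquad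 \mathcal E[T]=(N,E,\emptyset,H',L),$$ $\mathscr G_{\alpha,\beta}[T]=\alpha|h_0|+\beta|N\setminus h_0|$ and $\mathscr F_0^{\gamma,\alpha,\beta}=\{T:\mathscr G_{\alpha,\beta}[T]\le\gamma\}$. *Dual elements.* A dual element $f$ is a family $\langle f,T\rangle\in L^0\big(\Omega\times\Omega^{\times|H^T|},\mathbb P\times\mathbb P^{\times|H^T|};(\mathbb R^d)^{\otimes|N^T|}\big)$, $T\in\mathscr F_0^{\gamma,\alpha,\beta}$, with variables $\omega_0$ and $(\omega_h)_{h\in H^T}$ and with tensor legs indexed by the nodes, which is compatible with isomorphisms of forests. *Convolution.* A cut of a Lions forest selects, in every component tree, one of the following: to keep the tree; to prune it entirely; or a non-empty set of edges such that every path from a node to the root contains at most one of them. Let $N_c^R$ be the set of nodes which stay connected to a root that has not been pruned, and $N_c^P=N\setminus N_c^R$. The root $T_c^R$ and the prune $T_c^P$ are the restrictions of $T$ to these two sets, with $0$-hyperedges $h_0\cap N_c^{R}$, $h_0\cap N_c^{P}$ and hyperedges the non-empty traces of the elements of $H^T$. For $f,g$ dual elements, $$\langle f*g,T\rangle=\sum_c\langle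 f,T_c^P\rangle\otimes^{H^T}\langle g,T_c^R\rangle ,$$ where the sum runs over all cuts (so that, for a non-empty tree, it contains the terms $\langle f,T\rangle\langle g,\mathbf 1\rangle$ and $\langle f,\mathbf 1\rangle\langle g,T\rangle$), and where in the coupled tensor product $\otimes^{H^T}$ both factors are evaluated at the same $\omega_0$, and each hyperedge of $T_c^P$ or $T_c^R$ uses the variable $\omega_h$ of the hyperedge $h\in H^T$ it comes from. Let $\epsilon$ be the counit, $\langle\epsilon,\mathbf 1\rangle=1$ and $\langle\epsilon,T\rangle=0$ for $T\neq\mathbf 1$, and $\mathscr S[f]=\sum_{n\ge0}(\epsilon-f)^{*n}$, which is a finite sum on each $T$ when $\langle f,\mathbf 1\rangle=1$. *Characters.* $f$ is a character if $\langle f,\mathbf 1\rangle=1$ and $\langle f,T_1\circledast T_2\rangle(\omega_0,\omega_{H_1},\omega_{H_2})=\langle f,T_1\rangle(\omega_0,\omega_{H_1})\otimes\langle f,T_2\rangle(\omega_0,\omega_{H_2})$ almost surely whenever $T_1\circledast T_2\in\mathscr F_0^{\gamma,\alpha,\beta}$. A character $f$ is *$\mathcal E$-invariant* if for all $T\in\mathscr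 F_0^{\gamma,\alpha,\beta}$ with $h_0^T\ne\emptyset$ and $\mathcal E[T]\in\mathscr F_0^{\gamma,\alpha,\beta}$, $$\langle f,T\rangle(\omega_{h_0},\omega_{H^T})=\langle f,\mathcal E[T]\rangle(\omega_0,\omega_{h_0},\omega_{H^T})\quad\text{for }\mathbb P\times\mathbb P^{\times|H^{\mathcal E[T]}|}\text{-almost every }(\omega_0,\omega_{h_0},\omega_{H^T}).$$ It is a *McKean–Vlasov character* if it is $\mathcal E$-invariant and, for every $T\in\mathscr F_0^{\gamma,\alpha,\beta}$ with $h_0^T=\emptyset$, $\langle f,T\rangle(\omega_0,\omega_{H^T})$ is almost surely equal to a random variable which does not depend on $\omega_0$. **Proposition.** The characters form a group under $*$ with unit $\epsilon$ and inverse $f^{-1}=\mathscr S[f]$, and the McKean–Vlasov characters $G^{\gamma,\alpha,\beta}(L^0)$ form a subgroup of it; in particular they contain $\epsilon$ and are closed under $*$ and under $\mathscr S$. If $\alpha\le\beta$, the last requirement is automatic: a character is a McKean–Vlasov character if and only if it is $\mathcal E$-invariant. -/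

import Mathlib

open MeasureTheory
open scoped NNReal

noncomputable section

namespace Lions

/-! ### Lions forests -/

/-- `G` is a partition of the finite set `S` into non-empty blocks. -/
structure IsPartition (G : Finset (Finset ℕ)) (S : Finset ℕ) : Prop where
  empty_notMem : ∅ ∉ G
  disjoint : ∀ g ∈ G, ∀ g' ∈ G, g ≠ g' → Disjoint g g'
  cover : ∀ x, x ∈ S ↔ ∃ g ∈ G, x ∈ g

/-- The trace `{g ∩ A : g ∈ G} \ {∅}` of a family of sets on `A`. -/
def trace (G : Finset (Finset ℕ)) (A : Finset ℕ) : Finset (Finset ℕ) :=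
  (G.image (fun g => g ∩ A)).erase ∅

/-- There is a directed edge from `x` to `y`. Edges point towards the roots, so that `y` is the
parent of `x`. -/
def Edge (E : Finset (ℕ × ℕ)) (x y : ℕ) : Prop := (x, y) ∈ E

/-- `Below E x z`: the directed path which starts at `x` passes through `z`
(`z = x` is allowed). -/
def Below (E : Finset (ℕ × ℕ)) : ℕ → ℕ → Prop := Relation.ReflTransGen (Edge E)

/-- The number of nodes on the path from `x` to its root. It induces the (pre)order on nodes:
`x < y` means `depth E x < depth E y`, and `x ≤ ≥ y` means `depth E x = depth E y`. -/
def depth (E : Finset (ℕ × ℕ)) (x : ℕ) : ℕ := {z | Below E x z}.ncard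

/-- The hyperedges `H' = (H ∪ {h₀}) \ {∅}`, the `0`-hyperedge being included when it is
non-empty. -/
def primed (h₀ : Finset ℕ) (H : Finset (Finset ℕ)) : Finset (Finset ℕ) := (insert h₀ H).erase ∅

/-- A Lions forest `(N, E, h₀, H, L)` with labels in `{1, …, d}`. The nodes are natural numbers.
The empty forest `𝟏` (no nodes) is included, so that this is the set `𝓕₀`.
A finite directed graph is a directed forest (every connected component is a directed tree whose
edges point to its root) exactly when it has no directed cycle and every node has at most one
outgoing edge. -/
@[ext]
structure LionsForest (d : ℕ) where
  N : Finset ℕ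
  E : Finset (ℕ × ℕ)
  h₀ : Finset ℕ
  H : Finset (Finset ℕ)
  L : N → Fin d
  E_subset : ∀ x y, (x, y) ∈ E → x ∈ N ∧ y ∈ N
  E_functional : ∀ x y z, (x, y) ∈ E → (x, z) ∈ E → y = z
  E_acyclic : ∀ x, ¬ Relation.TransGen (Edge E) x x
  h₀_subset : h₀ ⊆ N
  H_partition : IsPartition H (N \ h₀)
  h₀_root : h₀.Nonempty → ∃ x ∈ h₀, ∀ y ∈ N, depth E x ≤ depth E y
  parent_mem : ∀ h ∈ primed h₀ H, ∀ x ∈ h, ∀ y ∈ h, depth E x < depth E y →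
    ∃ z ∈ h, (y, z) ∈ E
  parents_mem : ∀ h ∈ primed h₀ H, ∀ x₁ ∈ h, ∀ y₁ ∈ h, depth E x₁ = depth E y₁ →
    ∀ x₂ y₂, (x₁, x₂) ∈ E → (y₁, y₂) ∈ E → x₂ ≠ y₂ → x₂ ∈ h ∧ y₂ ∈ h

/-! ### Facts about depths, needed to see that the operations below produce Lions forests -/

lemma reach_finite (E : Finset (ℕ × ℕ)) (x : ℕ) : {z | Below E x z}.Finite := by
  refine ((insert x (E.image Prod.snd)).finite_toSet).subset ?_
  intro z hz
  rcases Relation.ReflTransGen.cases_tail hz with h | ⟨w, _, hw⟩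
  · simp [h]
  · have : z ∈ E.image Prod.snd := Finset.mem_image.2 ⟨(w, z), hw, rfl⟩
    simp only [Finset.coe_insert, Set.mem_insert_iff, Finset.mem_coe]
    exact Or.inr this

lemma one_le_depth (E : Finset (ℕ × ℕ)) (x : ℕ) : 1 ≤ depth E x :=
  (Set.ncard_pos (reach_finite E x)).2 ⟨x, Relation.ReflTransGen.refl⟩

lemma depth_of_root {E : Finset (ℕ × ℕ)} {x : ℕ} (h : ∀ y, (x, y) ∉ E) : depth E x = 1 := by
  have : {z | Below E x z} = {x} := by
    ext z
    constructor
    · intro hz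
      rcases Relation.ReflTransGen.cases_head hz with h1 | ⟨w, hw, _⟩
      · exact h1.symm
      · exact absurd hw (h w)
    · rintro rfl
      exact Relation.ReflTransGen.refl
  simp [depth, this]

lemma depth_of_edge {E : Finset (ℕ × ℕ)}
    (hf : ∀ x y z, (x, y) ∈ E → (x, z) ∈ E → y = z)
    (ha : ∀ x, ¬ Relation.TransGen (Edge E) x x) {x y : ℕ} (h : (x, y) ∈ E) :
    depth E x = depth E y + 1 := by
  have h1 : {z | Below E x z} = insert x {z | Below E y z} := by
    ext z
    constructor
    · intro hz
      rcases Relation.ReflTransGen.cases_head hz with h1 | ⟨w, hw, hz'⟩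
      · exact Or.inl h1.symm
      · have : w = y := hf x w y hw h
        subst this
        exact Or.inr hz'
    · rintro (rfl | hz)
      · exact Relation.ReflTransGen.refl
      · exact Relation.ReflTransGen.head h hz
  have h2 : x ∉ {z | Below E y z} := fun hx => ha x (Relation.TransGen.head' h hx)
  rw [depth, h1, Set.ncard_insert_of_notMem h2 (reach_finite E y), depth]

lemma depth_le_of_below {E : Finset (ℕ × ℕ)} {x y : ℕ} (h : Below E x y) :
    depth E y ≤ depth E x :=
  Set.ncard_le_ncard (fun _ hz => Relation.ReflTransGen.trans h hz) (reach_finite E x)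

/-- In a Lions forest, if the parent `b` of a node `y` of the hyperedge `h` is not in `h`, then all
nodes of `h` are strict descendants of `b`. -/
lemma LionsForest.descend {d : ℕ} (T : LionsForest d) {h : Finset ℕ} (hh : h ∈ primed T.h₀ T.H)
    {y b : ℕ} (hy : y ∈ h) (hyb : (y, b) ∈ T.E) (hb : b ∉ h) :
    ∀ n x, depth T.E x = n → x ∈ h → ∃ w, Below T.E x w ∧ (w, b) ∈ T.E := by
  intro n
  induction n with
  | zero =>
    intro x hx _
    have := one_le_depth T.E x
    omega
  | succ n ih =>
    intro x hx hxh
    rcases lt_trichotomy (depth T.E x) (depth T.E y) with hlt | heq | hgt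
    · obtain ⟨z, hz, hyz⟩ := T.parent_mem h hh x hxh y hy hlt
      exact absurd (T.E_functional y z b hyz hyb ▸ hz) hb
    · by_cases hr : ∃ a, (x, a) ∈ T.E
      · obtain ⟨a, ha⟩ := hr
        by_cases hab : a = b
        · exact ⟨x, Relation.ReflTransGen.refl, hab ▸ ha⟩
        · exact absurd (T.parents_mem h hh x hxh y hy heq a b ha hyb hab).2 hb
      · push Not at hr
        have h1 := depth_of_root hr
        have h2 := depth_of_edge T.E_functional T.E_acyclic hyb
        have h3 := one_le_depth T.E b
        omega
    · obtain ⟨z, hz, hxz⟩ := T.parent_mem h hh y hy x hxh hgt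
      have h2 := depth_of_edge T.E_functional T.E_acyclic hxz
      obtain ⟨w, hw, hwb⟩ := ih z (by omega) hz
      exact ⟨w, Relation.ReflTransGen.head hxz hw, hwb⟩

lemma IsPartition.trace {G : Finset (Finset ℕ)} {S : Finset ℕ} (hG : IsPartition G S)
    (A : Finset ℕ) : IsPartition (trace G A) (S ∩ A) := by
  refine ⟨by simp [Lions.trace], ?_, ?_⟩
  · intro g hg g' hg' hne
    simp only [Lions.trace, Finset.mem_erase, Finset.mem_image] at hg hg'
    obtain ⟨_, a, ha, rfl⟩ := hg
    obtain ⟨_, b, hb, rfl⟩ := hg'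
    have hab : a ≠ b := fun h => hne (by rw [h])
    exact (hG.disjoint a ha b hb hab).mono Finset.inter_subset_left Finset.inter_subset_left
  · intro x
    simp only [Lions.trace, Finset.mem_erase, Finset.mem_image, Finset.mem_inter, hG.cover x]
    constructor
    · rintro ⟨⟨g, hg, hxg⟩, hxA⟩
      have hx : x ∈ g ∩ A := Finset.mem_inter.2 ⟨hxg, hxA⟩
      exact ⟨g ∩ A, ⟨Finset.ne_empty_of_mem hx, g, hg, rfl⟩, hx⟩
    · rintro ⟨_, ⟨_, g, hg, rfl⟩, hx⟩
      exact ⟨⟨g, hg, (Finset.mem_inter.1 hx).1⟩, (Finset.mem_inter.1 hx).2⟩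

/-- The edges between nodes of `A`. -/
def restrictE (E : Finset (ℕ × ℕ)) (A : Finset ℕ) : Finset (ℕ × ℕ) :=
  E.filter (fun e => e.1 ∈ A ∧ e.2 ∈ A)

lemma mem_restrictE {E : Finset (ℕ × ℕ)} {A : Finset ℕ} {x y : ℕ} :
    (x, y) ∈ restrictE E A ↔ (x, y) ∈ E ∧ x ∈ A ∧ y ∈ A := by
  simp [restrictE]

lemma restrictE_acyclic {E : Finset (ℕ × ℕ)} (A : Finset ℕ)
    (ha : ∀ x, ¬ Relation.TransGen (Edge E) x x) (x : ℕ) :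
    ¬ Relation.TransGen (Edge (restrictE E A)) x x := by
  intro h
  have hm : ∀ {a b}, Relation.TransGen (Edge (restrictE E A)) a b →
      Relation.TransGen (Edge E) a b := by
    intro a b hab
    induction hab with
    | single h1 => exact Relation.TransGen.single (mem_restrictE.1 h1).1
    | tail _ h2 ih => exact Relation.TransGen.tail ih (mem_restrictE.1 h2).1
  exact ha x (hm h)

lemma LionsForest.depth_restrict {d : ℕ} (T : LionsForest d) {A : Finset ℕ} {a b : ℕ}
    (hab : (a, b) ∈ restrictE T.E A) :
    depth (restrictE T.E A) a = depth (restrictE T.E A) b + 1 :=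
  depth_of_edge
    (fun x y z h h' => T.E_functional x y z (mem_restrictE.1 h).1 (mem_restrictE.1 h').1)
    (restrictE_acyclic A T.E_acyclic) hab

/-- The `0`-hyperedge of a Lions forest contains the parents of its nodes. -/
lemma LionsForest.h₀_parent {d : ℕ} (T : LionsForest d) {x z : ℕ} (hx : x ∈ T.h₀)
    (hxz : (x, z) ∈ T.E) : z ∈ T.h₀ := by
  have h0 : T.h₀ ∈ primed T.h₀ T.H := by
    simp only [primed, Finset.mem_erase, Finset.mem_insert, true_or, and_true]
    exact Finset.ne_empty_of_mem hx
  obtain ⟨r, hr, hrmin⟩ := T.h₀_root ⟨x, hx⟩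
  have hd := depth_of_edge T.E_functional T.E_acyclic hxz
  have hlt : depth T.E r < depth T.E x := by
    have := hrmin z (T.E_subset x z hxz).2
    omega
  obtain ⟨z', hz', hxz'⟩ := T.parent_mem _ h0 r hr x hx hlt
  exact T.E_functional x z' z hxz' hxz ▸ hz'

/-- `A` contains every node on a directed path between two of its nodes. -/
def PathConvex (E : Finset (ℕ × ℕ)) (A : Finset ℕ) : Prop :=
  ∀ x ∈ A, ∀ z ∈ A, ∀ y, Below E x y → Below E y z → y ∈ A

lemma below_restrict {E : Finset (ℕ × ℕ)} {A : Finset ℕ} (hA : PathConvex E A) {z : ℕ}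
    (hz : z ∈ A) {x : ℕ} (h : Below E x z) : x ∈ A → Below (restrictE E A) x z := by
  induction h using Relation.ReflTransGen.head_induction_on with
  | refl => exact fun _ => Relation.ReflTransGen.refl
  | head hab hbz ih =>
    intro ha
    have hb := hA _ ha _ hz _ (Relation.ReflTransGen.single hab) hbz
    exact Relation.ReflTransGen.head (mem_restrictE.2 ⟨hab, ha, hb⟩) (ih hb)

lemma primed_restrict {h₀ A h : Finset ℕ} {H : Finset (Finset ℕ)}
    (hh : h ∈ primed (h₀ ∩ A) (trace H A)) : ∃ k ∈ primed h₀ H, h = k ∩ A := by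
  simp only [primed, trace, Finset.mem_erase, Finset.mem_insert, Finset.mem_image] at hh
  obtain ⟨hne, rfl | ⟨_, k, hk, rfl⟩⟩ := hh
  · refine ⟨h₀, ?_, rfl⟩
    simp only [primed, Finset.mem_erase, Finset.mem_insert, true_or, and_true]
    rintro rfl
    simp at hne
  · refine ⟨k, ?_, rfl⟩
    simp only [primed, Finset.mem_erase, Finset.mem_insert, hk, or_true, and_true]
    rintro rfl
    simp at hne

/-! ### Operations on Lions forests -/

/-- The Lions forest induced on a set of nodes: nodes `A`, the edges inside `A`, the `0`-hyperedge
`h₀ ∩ A`, the hyperedges `{h ∩ A : h ∈ H} \ {∅}` and the restricted labels. -/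
def LionsForest.restrict {d : ℕ} (T : LionsForest d) (A : Finset ℕ) (hAN : A ⊆ T.N)
    (hA : PathConvex T.E A) : LionsForest d where
  N := A
  E := restrictE T.E A
  h₀ := T.h₀ ∩ A
  H := trace T.H A
  L := fun x => T.L ⟨x.1, hAN x.2⟩
  E_subset := fun x y h => (mem_restrictE.1 h).2
  E_functional := fun x y z h h' =>
    T.E_functional x y z (mem_restrictE.1 h).1 (mem_restrictE.1 h').1
  E_acyclic := restrictE_acyclic A T.E_acyclic
  h₀_subset := Finset.inter_subset_right
  H_partition := by
    have h := T.H_partition.trace A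
    have e : (T.N \ T.h₀) ∩ A = A \ (T.h₀ ∩ A) := by
      ext x
      have := @hAN x
      simp only [Finset.mem_inter, Finset.mem_sdiff]
      tauto
    rwa [e] at h
  h₀_root := by
    intro hne
    obtain ⟨x, hx, hmin⟩ := Finset.exists_min_image _ (depth (restrictE T.E A)) hne
    refine ⟨x, hx, fun y _ => ?_⟩
    have hroot : ∀ z, (x, z) ∉ restrictE T.E A := by
      intro z hz
      have hxz := mem_restrictE.1 hz
      have hz0 := T.h₀_parent (Finset.mem_inter.1 hx).1 hxz.1
      have h1 := hmin z (Finset.mem_inter.2 ⟨hz0, hxz.2.2⟩)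
      have h2 := T.depth_restrict hz
      omega
    rw [depth_of_root hroot]
    exact one_le_depth _ _
  parent_mem := by
    intro h hh x hx y hy hlt
    obtain ⟨k, hk, rfl⟩ := primed_restrict hh
    obtain ⟨hxk, hxA⟩ := Finset.mem_inter.1 hx
    obtain ⟨hyk, hyA⟩ := Finset.mem_inter.1 hy
    have hedge : ∃ z, (y, z) ∈ restrictE T.E A := by
      by_contra hc
      push Not at hc
      have h1 := depth_of_root hc
      have h2 := one_le_depth (restrictE T.E A) x
      omega
    obtain ⟨z, hz⟩ := hedge
    have hyz := mem_restrictE.1 hz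
    refine ⟨z, Finset.mem_inter.2 ⟨?_, hyz.2.2⟩, hz⟩
    by_contra hzk
    obtain ⟨w, hw, hwz⟩ := T.descend hk hyk hyz.1 hzk _ x rfl hxk
    have hwA := hA x hxA z hyz.2.2 w hw (Relation.ReflTransGen.single hwz)
    have h1 := depth_le_of_below (below_restrict hA hwA hw hxA)
    have h2 := T.depth_restrict hz
    have h3 := T.depth_restrict (mem_restrictE.2 ⟨hwz, hwA, hyz.2.2⟩)
    omega
  parents_mem := by
    have key : ∀ h ∈ primed (T.h₀ ∩ A) (trace T.H A), ∀ x₁ ∈ h, ∀ y₁ ∈ h,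
        depth (restrictE T.E A) x₁ = depth (restrictE T.E A) y₁ →
        ∀ x₂ y₂, (x₁, x₂) ∈ restrictE T.E A → (y₁, y₂) ∈ restrictE T.E A → x₂ ≠ y₂ →
        x₂ ∈ h := by
      intro h hh x₁ hx₁ y₁ hy₁ heq x₂ y₂ hx hy hne
      obtain ⟨k, hk, rfl⟩ := primed_restrict hh
      obtain ⟨hxk, hxA⟩ := Finset.mem_inter.1 hx₁
      obtain ⟨hyk, hyA⟩ := Finset.mem_inter.1 hy₁
      have hx' := mem_restrictE.1 hx
      have hy' := mem_restrictE.1 hy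
      refine Finset.mem_inter.2 ⟨?_, hx'.2.2⟩
      by_contra hxk2
      obtain ⟨w, hw, hwx⟩ := T.descend hk hxk hx'.1 hxk2 _ y₁ rfl hyk
      have hwA := hA y₁ hyA x₂ hx'.2.2 w hw (Relation.ReflTransGen.single hwx)
      have hyw := below_restrict hA hwA hw hyA
      have h2 := T.depth_restrict hx
      have h3 := T.depth_restrict (mem_restrictE.2 ⟨hwx, hwA, hx'.2.2⟩)
      rcases Relation.ReflTransGen.cases_head hyw with e | ⟨b, hb, hbw⟩
      · subst e
        exact hne (T.E_functional _ _ _ hwx hy'.1)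
      · have h4 := T.depth_restrict hb
        have h5 := depth_le_of_below hbw
        omega
    intro h hh x₁ hx₁ y₁ hy₁ heq x₂ y₂ hx hy hne
    exact ⟨key h hh x₁ hx₁ y₁ hy₁ heq x₂ y₂ hx hy hne,
      key h hh y₁ hy₁ x₁ hx₁ heq.symm y₂ x₂ hy hx hne.symm⟩

lemma below_union {N₁ N₂ : Finset ℕ} {E₁ E₂ : Finset (ℕ × ℕ)} (hd : Disjoint N₁ N₂)
    (h₁ : ∀ x y, (x, y) ∈ E₁ → x ∈ N₁ ∧ y ∈ N₁) (h₂ : ∀ x y, (x, y) ∈ E₂ → x ∈ N₂ ∧ y ∈ N₂)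
    {x : ℕ} (hx : x ∈ N₁) (z : ℕ) : Below (E₁ ∪ E₂) x z ↔ Below E₁ x z := by
  constructor
  · intro h
    have : Below E₁ x z ∧ z ∈ N₁ := by
      induction h with
      | refl => exact ⟨Relation.ReflTransGen.refl, hx⟩
      | tail _ hbc ih =>
        rcases Finset.mem_union.1 hbc with h | h
        · exact ⟨Relation.ReflTransGen.tail ih.1 h, (h₁ _ _ h).2⟩
        · exact absurd (h₂ _ _ h).1 (Finset.disjoint_left.1 hd ih.2)
    exact this.1
  · intro h
    induction h with
    | refl => exact Relation.ReflTransGen.refl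
    | tail _ hbc ih => exact Relation.ReflTransGen.tail ih (Finset.mem_union_left _ hbc)

lemma LionsForest.depth_union_left {d : ℕ} (T₁ T₂ : LionsForest d) (hd : Disjoint T₁.N T₂.N)
    {x : ℕ} (hx : x ∈ T₁.N) : depth (T₁.E ∪ T₂.E) x = depth T₁.E x := by
  have : {z | Below (T₁.E ∪ T₂.E) x z} = {z | Below T₁.E x z} :=
    Set.ext (fun z => below_union hd T₁.E_subset T₂.E_subset hx z)
  rw [depth, this, depth]

lemma LionsForest.depth_union_right {d : ℕ} (T₁ T₂ : LionsForest d) (hd : Disjoint T₁.N T₂.N)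
    {x : ℕ} (hx : x ∈ T₂.N) : depth (T₁.E ∪ T₂.E) x = depth T₂.E x := by
  rw [Finset.union_comm]
  exact T₂.depth_union_left T₁ hd.symm hx

lemma LionsForest.subset_of_mem_H {d : ℕ} (T : LionsForest d) {h : Finset ℕ} (hh : h ∈ T.H) :
    h ⊆ T.N \ T.h₀ := fun x hx => (T.H_partition.cover x).2 ⟨h, hh, hx⟩

lemma LionsForest.mem_primed {d : ℕ} (T : LionsForest d) {h : Finset ℕ} (hh : h ∈ T.H) :
    h ∈ primed T.h₀ T.H := by
  simp only [primed, Finset.mem_erase, Finset.mem_insert, hh, or_true, and_true]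
  rintro rfl
  exact T.H_partition.empty_notMem hh

lemma IsPartition.union {G₁ G₂ : Finset (Finset ℕ)} {S₁ S₂ : Finset ℕ} (h₁ : IsPartition G₁ S₁)
    (h₂ : IsPartition G₂ S₂) (hd : Disjoint S₁ S₂) : IsPartition (G₁ ∪ G₂) (S₁ ∪ S₂) := by
  have s₁ : ∀ g ∈ G₁, g ⊆ S₁ := fun g hg x hx => (h₁.cover x).2 ⟨g, hg, hx⟩
  have s₂ : ∀ g ∈ G₂, g ⊆ S₂ := fun g hg x hx => (h₂.cover x).2 ⟨g, hg, hx⟩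
  refine ⟨?_, ?_, ?_⟩
  · simp [h₁.empty_notMem, h₂.empty_notMem]
  · intro g hg g' hg' hne
    rcases Finset.mem_union.1 hg with h | h <;> rcases Finset.mem_union.1 hg' with h' | h'
    · exact h₁.disjoint g h g' h' hne
    · exact hd.mono (s₁ g h) (s₂ g' h')
    · exact (hd.mono (s₁ g' h') (s₂ g h)).symm
    · exact h₂.disjoint g h g' h' hne
  · intro x
    simp only [Finset.mem_union, h₁.cover x, h₂.cover x]
    constructor
    · rintro (⟨g, hg, hx⟩ | ⟨g, hg, hx⟩)
      · exact ⟨g, Or.inl hg, hx⟩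
      · exact ⟨g, Or.inr hg, hx⟩
    · rintro ⟨g, hg | hg, hx⟩
      · exact Or.inl ⟨g, hg, hx⟩
      · exact Or.inr ⟨g, hg, hx⟩

lemma sdiff_union_sdiff {N₁ N₂ A₁ A₂ : Finset ℕ} (hd : Disjoint N₁ N₂) (h₁ : A₁ ⊆ N₁)
    (h₂ : A₂ ⊆ N₂) : N₁ \ A₁ ∪ N₂ \ A₂ = (N₁ ∪ N₂) \ (A₁ ∪ A₂) := by
  ext x
  have a := @h₁ x
  have b := @h₂ x
  have c : x ∈ N₁ → x ∉ N₂ := fun h => Finset.disjoint_left.1 hd h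
  simp only [Finset.mem_union, Finset.mem_sdiff]
  tauto

/-- The product `T₁ ⊛ T₂` of two Lions forests with disjoint sets of nodes: the `0`-hyperedges are
merged and everything else is kept apart. -/
def LionsForest.mul {d : ℕ} (T₁ T₂ : LionsForest d) (hd : Disjoint T₁.N T₂.N) :
    LionsForest d where
  N := T₁.N ∪ T₂.N
  E := T₁.E ∪ T₂.E
  h₀ := T₁.h₀ ∪ T₂.h₀
  H := T₁.H ∪ T₂.H
  L := fun x => if h : x.1 ∈ T₁.N then T₁.L ⟨x.1, h⟩ else
    T₂.L ⟨x.1, (Finset.mem_union.1 x.2).resolve_left h⟩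
  E_subset := by
    intro x y h
    rcases Finset.mem_union.1 h with h | h
    · exact ⟨Finset.mem_union_left _ (T₁.E_subset x y h).1,
        Finset.mem_union_left _ (T₁.E_subset x y h).2⟩
    · exact ⟨Finset.mem_union_right _ (T₂.E_subset x y h).1,
        Finset.mem_union_right _ (T₂.E_subset x y h).2⟩
  E_functional := by
    intro x y z h h'
    rcases Finset.mem_union.1 h with h | h <;> rcases Finset.mem_union.1 h' with h' | h'
    · exact T₁.E_functional x y z h h'
    · exact absurd (T₂.E_subset x z h').1 (Finset.disjoint_left.1 hd (T₁.E_subset x y h).1)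
    · exact absurd (T₂.E_subset x y h).1 (Finset.disjoint_left.1 hd (T₁.E_subset x z h').1)
    · exact T₂.E_functional x y z h h'
  E_acyclic := by
    intro x h
    obtain ⟨b, hb, hbx⟩ := Relation.TransGen.head'_iff.1 h
    rcases Finset.mem_union.1 hb with h | h
    · exact T₁.E_acyclic x (Relation.TransGen.head' h
        ((below_union hd T₁.E_subset T₂.E_subset (T₁.E_subset x b h).2 x).1 hbx))
    · rw [Finset.union_comm] at hbx
      exact T₂.E_acyclic x (Relation.TransGen.head' h
        ((below_union hd.symm T₂.E_subset T₁.E_subset (T₂.E_subset x b h).2 x).1 hbx))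
  h₀_subset := Finset.union_subset_union T₁.h₀_subset T₂.h₀_subset
  H_partition := by
    have h := T₁.H_partition.union T₂.H_partition
      (hd.mono Finset.sdiff_subset Finset.sdiff_subset)
    rwa [sdiff_union_sdiff hd T₁.h₀_subset T₂.h₀_subset] at h
  h₀_root := by
    have aux : ∀ T : LionsForest d, T.h₀.Nonempty → ∃ x ∈ T.h₀, depth T.E x = 1 := by
      intro T hne
      obtain ⟨x, hx, hmin⟩ := T.h₀_root hne
      refine ⟨x, hx, depth_of_root fun y hy => ?_⟩
      have h1 := hmin y (T.E_subset x y hy).2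
      have h2 := depth_of_edge T.E_functional T.E_acyclic hy
      omega
    rintro ⟨x, hx⟩
    rcases Finset.mem_union.1 hx with h | h
    · obtain ⟨r, hr, hr1⟩ := aux T₁ ⟨x, h⟩
      refine ⟨r, Finset.mem_union_left _ hr, fun y _ => ?_⟩
      rw [T₁.depth_union_left T₂ hd (T₁.h₀_subset hr), hr1]
      exact one_le_depth _ _
    · obtain ⟨r, hr, hr1⟩ := aux T₂ ⟨x, h⟩
      refine ⟨r, Finset.mem_union_right _ hr, fun y _ => ?_⟩
      rw [T₁.depth_union_right T₂ hd (T₂.h₀_subset hr), hr1]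
      exact one_le_depth _ _
  parent_mem := by
    intro h hh x hx y hy hlt
    simp only [primed, Finset.mem_erase, Finset.mem_insert, Finset.mem_union] at hh
    rcases hh with ⟨_, rfl | hh | hh⟩
    · have hyr : ∃ z, (y, z) ∈ T₁.E ∪ T₂.E := by
        by_contra hc
        push Not at hc
        have h1 := depth_of_root hc
        have h2 := one_le_depth (T₁.E ∪ T₂.E) x
        omega
      obtain ⟨z, hz⟩ := hyr
      refine ⟨z, ?_, hz⟩
      rcases Finset.mem_union.1 hz with h | h <;> rcases Finset.mem_union.1 hy with hy | hy
      · exact Finset.mem_union_left _ (T₁.h₀_parent hy h)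
      · exact absurd (T₂.h₀_subset hy) (Finset.disjoint_left.1 hd (T₁.E_subset y z h).1)
      · exact absurd (T₂.E_subset y z h).1 (Finset.disjoint_left.1 hd (T₁.h₀_subset hy))
      · exact Finset.mem_union_right _ (T₂.h₀_parent hy h)
    · have s : h ⊆ T₁.N := (T₁.subset_of_mem_H hh).trans Finset.sdiff_subset
      rw [T₁.depth_union_left T₂ hd (s hx), T₁.depth_union_left T₂ hd (s hy)] at hlt
      obtain ⟨z, hz, hyz⟩ := T₁.parent_mem h (T₁.mem_primed hh) x hx y hy hlt
      exact ⟨z, hz, Finset.mem_union_left _ hyz⟩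
    · have s : h ⊆ T₂.N := (T₂.subset_of_mem_H hh).trans Finset.sdiff_subset
      rw [T₁.depth_union_right T₂ hd (s hx), T₁.depth_union_right T₂ hd (s hy)] at hlt
      obtain ⟨z, hz, hyz⟩ := T₂.parent_mem h (T₂.mem_primed hh) x hx y hy hlt
      exact ⟨z, hz, Finset.mem_union_right _ hyz⟩
  parents_mem := by
    intro h hh x₁ hx₁ y₁ hy₁ heq x₂ y₂ hx hy hne
    simp only [primed, Finset.mem_erase, Finset.mem_insert, Finset.mem_union] at hh
    rcases hh with ⟨_, rfl | hh | hh⟩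
    · have key : ∀ a ∈ T₁.h₀ ∪ T₂.h₀, ∀ b, (a, b) ∈ T₁.E ∪ T₂.E → b ∈ T₁.h₀ ∪ T₂.h₀ := by
        intro a ha b hab
        rcases Finset.mem_union.1 hab with h | h <;> rcases Finset.mem_union.1 ha with ha | ha
        · exact Finset.mem_union_left _ (T₁.h₀_parent ha h)
        · exact absurd (T₂.h₀_subset ha) (Finset.disjoint_left.1 hd (T₁.E_subset a b h).1)
        · exact absurd (T₂.E_subset a b h).1 (Finset.disjoint_left.1 hd (T₁.h₀_subset ha))
        · exact Finset.mem_union_right _ (T₂.h₀_parent ha h)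
      exact ⟨key _ hx₁ _ hx, key _ hy₁ _ hy⟩
    · have s : h ⊆ T₁.N := (T₁.subset_of_mem_H hh).trans Finset.sdiff_subset
      rw [T₁.depth_union_left T₂ hd (s hx₁), T₁.depth_union_left T₂ hd (s hy₁)] at heq
      have e : ∀ a ∈ h, ∀ b, (a, b) ∈ T₁.E ∪ T₂.E → (a, b) ∈ T₁.E := by
        intro a ha b hab
        refine (Finset.mem_union.1 hab).resolve_right fun h2 => ?_
        exact Finset.disjoint_left.1 hd (s ha) (T₂.E_subset a b h2).1
      exact T₁.parents_mem h (T₁.mem_primed hh) x₁ hx₁ y₁ hy₁ heq x₂ y₂ (e _ hx₁ _ hx)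
        (e _ hy₁ _ hy) hne
    · have s : h ⊆ T₂.N := (T₂.subset_of_mem_H hh).trans Finset.sdiff_subset
      rw [T₁.depth_union_right T₂ hd (s hx₁), T₁.depth_union_right T₂ hd (s hy₁)] at heq
      have e : ∀ a ∈ h, ∀ b, (a, b) ∈ T₁.E ∪ T₂.E → (a, b) ∈ T₂.E := by
        intro a ha b hab
        refine (Finset.mem_union.1 hab).resolve_left fun h2 => ?_
        exact Finset.disjoint_left.1 hd (T₁.E_subset a b h2).1 (s ha)
      exact T₂.parents_mem h (T₂.mem_primed hh) x₁ hx₁ y₁ hy₁ heq x₂ y₂ (e _ hx₁ _ hx)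
        (e _ hy₁ _ hy) hne

lemma primed_empty_primed (h₀ : Finset ℕ) (H : Finset (Finset ℕ)) :
    primed ∅ (primed h₀ H) = primed h₀ H := by
  ext h
  simp only [primed, Finset.mem_erase, Finset.mem_insert]
  tauto

/-- The operator `𝓔[(N, E, h₀, H, L)] = (N, E, ∅, H', L)`. -/
def LionsForest.calE {d : ℕ} (T : LionsForest d) : LionsForest d where
  N := T.N
  E := T.E
  h₀ := ∅
  H := primed T.h₀ T.H
  L := T.L
  E_subset := T.E_subset
  E_functional := T.E_functional
  E_acyclic := T.E_acyclic
  h₀_subset := Finset.empty_subset _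
  H_partition := by
    have hm : ∀ g, g ∈ primed T.h₀ T.H ↔ g ≠ ∅ ∧ (g = T.h₀ ∨ g ∈ T.H) := by
      intro g
      simp only [primed, Finset.mem_erase, Finset.mem_insert]
    have hd : ∀ g ∈ T.H, Disjoint T.h₀ g := fun g hg =>
      Finset.disjoint_left.2 fun x hx hxg =>
        (Finset.mem_sdiff.1 (T.subset_of_mem_H hg hxg)).2 hx
    refine ⟨by simp [primed], ?_, ?_⟩
    · intro g hg g' hg' hne
      rcases (hm g).1 hg with ⟨_, rfl | hg⟩ <;> rcases (hm g').1 hg' with ⟨_, rfl | hg'⟩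
      · exact absurd rfl hne
      · exact hd g' hg'
      · exact (hd g hg).symm
      · exact T.H_partition.disjoint g hg g' hg' hne
    · intro x
      simp only [Finset.sdiff_empty]
      constructor
      · intro hx
        by_cases hx0 : x ∈ T.h₀
        · exact ⟨T.h₀, (hm _).2 ⟨Finset.ne_empty_of_mem hx0, Or.inl rfl⟩, hx0⟩
        · obtain ⟨g, hg, hxg⟩ := (T.H_partition.cover x).1 (Finset.mem_sdiff.2 ⟨hx, hx0⟩)
          exact ⟨g, T.mem_primed hg, hxg⟩
      · rintro ⟨g, hg, hxg⟩
        rcases (hm g).1 hg with ⟨_, rfl | hg⟩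
        · exact T.h₀_subset hxg
        · exact (Finset.mem_sdiff.1 (T.subset_of_mem_H hg hxg)).1
  h₀_root := by simp
  parent_mem := by
    rw [primed_empty_primed]
    exact T.parent_mem
  parents_mem := by
    rw [primed_empty_primed]
    exact T.parents_mem

/-- The weighted grading `α |h₀| + β |N \ h₀|`. -/
def LionsForest.grade {d : ℕ} (α β : ℝ≥0) (T : LionsForest d) : ℝ≥0 :=
  α * T.h₀.card + β * (T.N \ T.h₀).card

/-- The truncated set of forests `𝓕₀^{γ,α,β}`. -/
abbrev Trunc (d : ℕ) (α β γ : ℝ≥0) : Type := {T : LionsForest d // T.grade α β ≤ γ}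

/-! ### Admissible cuts -/

/-- The roots of the forest. -/
def LionsForest.roots {d : ℕ} (T : LionsForest d) : Finset ℕ :=
  T.N.filter (fun x => ∀ e ∈ T.E, e.1 ≠ x)

/-- A term of the coproduct of a Lions forest is given by a set `c` of edges and a set `S` of
roots. The component trees with root in `S` are pruned entirely; in every other component tree,
`c` is either empty or an admissible cut, that is, the path from any node to its root contains at
most one edge of `c` (the edges on this path are the edges which start at a node of the path). For
a tree with root `x`, the pair `(∅, ∅)` gives `𝟏 × T`, the pair `(∅, {x})` gives `T × 𝟏` and the
pairs `(c, ∅)` with `c ≠ ∅` give the admissible cuts. A general forest combines one choice for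
each of its component trees, so that the coproduct is multiplicative and commutes with `𝓔`. -/
structure LionsForest.IsCut {d : ℕ} (T : LionsForest d) (c : Finset (ℕ × ℕ)) (S : Finset ℕ) :
    Prop where
  edges : c ⊆ T.E
  roots : S ⊆ T.roots
  edge_unique : ∀ y ∈ T.N, ∀ e ∈ c, ∀ e' ∈ c, Below T.E y e.1 → Below T.E y e'.1 → e = e'
  edge_root : ∀ y ∈ T.N, ∀ e ∈ c, ∀ r ∈ S, Below T.E y e.1 → ¬ Below T.E y r

open Classical in
/-- The finite set of all cuts of a Lions forest, including the trivial ones. -/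
def LionsForest.cuts {d : ℕ} (T : LionsForest d) : Finset (Finset (ℕ × ℕ) × Finset ℕ) :=
  (T.E.powerset ×ˢ T.roots.powerset).filter (fun q => T.IsCut q.1 q.2)

open Classical in
/-- The nodes `N_c^R` which stay connected with a root that is not pruned. -/
def LionsForest.rootNodes {d : ℕ} (T : LionsForest d) (q : Finset (ℕ × ℕ) × Finset ℕ) :
    Finset ℕ :=
  T.N.filter (fun y => (∀ e ∈ q.1, ¬ Below T.E y e.1) ∧ ∀ r ∈ q.2, ¬ Below T.E y r)

lemma LionsForest.mem_N_of_below {d : ℕ} (T : LionsForest d) {x y : ℕ} (h : Below T.E x y)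
    (hx : x ∈ T.N) : y ∈ T.N := by
  rcases Relation.ReflTransGen.cases_tail h with rfl | ⟨w, _, hw⟩
  · exact hx
  · exact (T.E_subset w y hw).2

lemma LionsForest.rootNodes_convex {d : ℕ} (T : LionsForest d)
    (q : Finset (ℕ × ℕ) × Finset ℕ) : PathConvex T.E (T.rootNodes q) := by
  classical
  intro x hx z _ y hxy _
  simp only [LionsForest.rootNodes, Finset.mem_filter] at hx ⊢
  exact ⟨T.mem_N_of_below hxy hx.1,
    fun e he hye => hx.2.1 e he (Relation.ReflTransGen.trans hxy hye),
    fun r hr hyr => hx.2.2 r hr (Relation.ReflTransGen.trans hxy hyr)⟩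

lemma LionsForest.pruneNodes_convex {d : ℕ} (T : LionsForest d)
    (q : Finset (ℕ × ℕ) × Finset ℕ) : PathConvex T.E (T.N \ T.rootNodes q) := by
  intro x hx z hz y hxy hyz
  have hy := T.mem_N_of_below hxy (Finset.mem_sdiff.1 hx).1
  refine Finset.mem_sdiff.2 ⟨hy, fun hyR => (Finset.mem_sdiff.1 hz).2 ?_⟩
  simp only [LionsForest.rootNodes, Finset.mem_filter] at hyR ⊢
  exact ⟨T.mem_N_of_below hyz hy,
    fun e he hze => hyR.2.1 e he (Relation.ReflTransGen.trans hyz hze),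
    fun r hr hzr => hyR.2.2 r hr (Relation.ReflTransGen.trans hyz hzr)⟩

/-- The root `T_c^R` of a cut. -/
def LionsForest.rootPart {d : ℕ} (T : LionsForest d) (q : Finset (ℕ × ℕ) × Finset ℕ) :
    LionsForest d :=
  T.restrict (T.rootNodes q) (by classical exact Finset.filter_subset _ _)
    (T.rootNodes_convex q)

/-- The prune `T_c^P` of a cut. -/
def LionsForest.prunePart {d : ℕ} (T : LionsForest d) (q : Finset (ℕ × ℕ) × Finset ℕ) :
    LionsForest d :=
  T.restrict (T.N \ T.rootNodes q) Finset.sdiff_subset (T.pruneNodes_convex q)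

lemma LionsForest.grade_restrict {d : ℕ} (α β : ℝ≥0) (T : LionsForest d) (A : Finset ℕ)
    (hAN : A ⊆ T.N) (hA : PathConvex T.E A) :
    (T.restrict A hAN hA).grade α β ≤ T.grade α β := by
  have h1 : (T.h₀ ∩ A).card ≤ T.h₀.card := Finset.card_le_card Finset.inter_subset_left
  have h2 : (A \ (T.h₀ ∩ A)).card ≤ (T.N \ T.h₀).card := by
    refine Finset.card_le_card fun x hx => ?_
    have := @hAN x
    simp only [Finset.mem_inter, Finset.mem_sdiff] at hx ⊢
    tauto
  simp only [LionsForest.grade, LionsForest.restrict]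
  gcongr

/-- The root of a cut of a forest in the truncated set. -/
def Trunc.root {d : ℕ} {α β γ : ℝ≥0} (T : Trunc d α β γ) (q : Finset (ℕ × ℕ) × Finset ℕ) :
    Trunc d α β γ :=
  ⟨T.1.rootPart q, (T.1.grade_restrict α β _ _ _).trans T.2⟩

/-- The prune of a cut of a forest in the truncated set. -/
def Trunc.prune {d : ℕ} {α β γ : ℝ≥0} (T : Trunc d α β γ) (q : Finset (ℕ × ℕ) × Finset ℕ) :
    Trunc d α β γ :=
  ⟨T.1.prunePart q, (T.1.grade_restrict α β _ _ _).trans T.2⟩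

/-! ### Coupled partitions and coupled tensor products -/

/-- `G` is a coupled partition of the partitions `P` of `M` and `Q` of `N`. -/
structure IsCoupling (M N : Finset ℕ) (P Q G : Finset (Finset ℕ)) : Prop where
  partition : IsPartition G (M ∪ N)
  left : trace G M = P
  right : trace G N = Q

/-- The injection `ψ^{P,G} : P → G`, which sends `p` to the block `g` of `G` with `g ∩ M = p`. -/
def psi {M : Finset ℕ} {P G : Finset (Finset ℕ)} (h : trace G M = P) (p : P) : G :=
  have hp : ∃ g ∈ G, g ∩ M = p.1 := by
    have h1 : p.1 ∈ trace G M := h ▸ p.2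
    simpa using Finset.mem_image.1 (Finset.mem_of_mem_erase h1)
  ⟨hp.choose, hp.choose_spec.1⟩

section RandomVariables

variable {Ω : Type*} [MeasurableSpace Ω]

/-- The product measure `ℙ × ℙ^{× |H|}` on `Ω × Ω^{× |H|}`. The first coordinate is `ω₀`, the other
ones are indexed by the hyperedges in `H`. -/
abbrev prodMeasure (ℙ : Measure Ω) (H : Finset (Finset ℕ)) : Measure (Ω × (H → Ω)) :=
  ℙ.prod (Measure.pi fun _ => ℙ)

/-- The space `L⁰(Ω × Ω^{× |H|}, ℙ × ℙ^{× |H|}; (ℝ^d)^{⊗ |N|})`. A tensor in `(ℝ^d)^{⊗ |N|}` is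
given by its coordinates in the basis `⊗_{x ∈ N} e_{i x}`, `i : N → {1, …, d}`. -/
abbrev Coeff (ℙ : Measure Ω) (d : ℕ) (N : Finset ℕ) (H : Finset (Finset ℕ)) : Type _ :=
  (Ω × (H → Ω)) →ₘ[prodMeasure ℙ H] ((N → Fin d) → ℝ)

/-- The coupled tensor product
`(X ⊗^G Y)(ω₀, ω_G) = X(ω₀, ω_{ψ^{P,G}[P]}) ⊗ Y(ω₀, ω_{ψ^{Q,G}[Q]})`. -/
def coupledTensor {ℙ : Measure Ω} [IsProbabilityMeasure ℙ] {d : ℕ}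
    {M₁ M₂ N₁ N₂ K : Finset ℕ} {P Q G : Finset (Finset ℕ)}
    (hG : IsCoupling M₁ M₂ P Q G) (hK : N₁ ∪ N₂ = K)
    (X : Coeff ℙ d N₁ P) (Y : Coeff ℙ d N₂ Q) : Coeff ℙ d K G :=
  AEEqFun.mk
    (fun ω i =>
      X (ω.1, fun p => ω.2 (psi hG.left p))
        (fun x => i ⟨x.1, hK ▸ Finset.mem_union_left N₂ x.2⟩) *
      Y (ω.1, fun p => ω.2 (psi hG.right p))
        (fun x => i ⟨x.1, hK ▸ Finset.mem_union_right N₁ x.2⟩))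
    (by
      have hX := X.measurable
      have hY := Y.measurable
      have m₁ : Measurable fun ω : Ω × (G → Ω) => (ω.1, fun p => ω.2 (psi hG.left p)) := by
        fun_prop
      have m₂ : Measurable fun ω : Ω × (G → Ω) => (ω.1, fun p => ω.2 (psi hG.right p)) := by
        fun_prop
      refine Measurable.aestronglyMeasurable (measurable_pi_lambda _ fun i => ?_)
      exact ((measurable_pi_apply _).comp (hX.comp m₁)).mul
        ((measurable_pi_apply _).comp (hY.comp m₂)))

end RandomVariables

lemma trace_eq_self {G G' : Finset (Finset ℕ)} {S A : Finset ℕ} (hG : IsPartition G S)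
    (hA : S ⊆ A) (hG' : ∀ g ∈ G', Disjoint g A) : trace (G ∪ G') A = G := by
  have hs : ∀ g ∈ G, g ∩ A = g := fun g hg =>
    Finset.inter_eq_left.2 fun x hx => hA ((hG.cover x).2 ⟨g, hg, hx⟩)
  ext g
  simp only [trace, Finset.mem_erase, Finset.mem_image, Finset.mem_union]
  constructor
  · rintro ⟨hne, k, hk | hk, rfl⟩
    · rwa [hs k hk]
    · exact absurd (Finset.disjoint_iff_inter_eq_empty.1 (hG' k hk)) hne
  · intro hg
    refine ⟨?_, g, Or.inl hg, hs g hg⟩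
    rintro rfl
    exact hG.empty_notMem hg

/-- `H¹ ∪ H²` is a coupled partition of `H¹` and `H²` (no hyperedges are coupled). -/
lemma LionsForest.mul_coupling {d : ℕ} (T₁ T₂ : LionsForest d) (hd : Disjoint T₁.N T₂.N) :
    IsCoupling (T₁.N \ T₁.h₀) (T₂.N \ T₂.h₀) T₁.H T₂.H (T₁.mul T₂ hd).H := by
  have hd' : Disjoint (T₁.N \ T₁.h₀) (T₂.N \ T₂.h₀) :=
    hd.mono Finset.sdiff_subset Finset.sdiff_subset
  refine ⟨T₁.H_partition.union T₂.H_partition hd', ?_, ?_⟩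
  · exact trace_eq_self T₁.H_partition subset_rfl
      fun g hg => (hd'.mono_right (T₂.subset_of_mem_H hg)).symm
  · change trace (T₁.H ∪ T₂.H) _ = _
    rw [Finset.union_comm]
    exact trace_eq_self T₂.H_partition subset_rfl
      fun g hg => hd'.mono_left (T₁.subset_of_mem_H hg)

lemma LionsForest.cut_nodes {d : ℕ} (T : LionsForest d) (q : Finset (ℕ × ℕ) × Finset ℕ) :
    (T.prunePart q).N ∪ (T.rootPart q).N = T.N := by
  classical
  exact Finset.sdiff_union_of_subset (Finset.filter_subset _ _)

/-- A cut couples its prune and its root through the hyperedges of the original forest. -/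
lemma LionsForest.cut_coupling {d : ℕ} (T : LionsForest d) (q : Finset (ℕ × ℕ) × Finset ℕ) :
    IsCoupling ((T.prunePart q).N \ (T.prunePart q).h₀) ((T.rootPart q).N \ (T.rootPart q).h₀)
      (T.prunePart q).H (T.rootPart q).H T.H := by
  have key : ∀ A : Finset ℕ, trace T.H (A \ (T.h₀ ∩ A)) = trace T.H A := by
    intro A
    have : ∀ g ∈ T.H, g ∩ (A \ (T.h₀ ∩ A)) = g ∩ A := by
      intro g hg
      ext x
      have this : x ∈ g → x ∈ T.N \ T.h₀ := fun h => T.subset_of_mem_H hg h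
      simp only [Finset.mem_inter, Finset.mem_sdiff] at this ⊢
      tauto
    rw [trace, trace, Finset.image_congr this]
  refine ⟨?_, key _, key _⟩
  have e : (T.prunePart q).N \ (T.prunePart q).h₀ ∪ (T.rootPart q).N \ (T.rootPart q).h₀ =
      T.N \ T.h₀ := by
    ext x
    have h1 : x ∈ T.rootNodes q → x ∈ T.N := by
      classical
      exact fun h => (Finset.mem_filter.1 h).1
    simp only [LionsForest.prunePart, LionsForest.rootPart, LionsForest.restrict,
      Finset.mem_union, Finset.mem_inter, Finset.mem_sdiff]
    tauto
  rw [e]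
  exact T.H_partition

/-! ### The dual module, convolution and characters -/

/-- `T'` is obtained from `T` by renaming the nodes with `σ`. Any isomorphism of Lions forests is
of this form. -/
structure IsRelabelling {d : ℕ} (σ : Equiv.Perm ℕ) (T T' : LionsForest d) : Prop where
  nodes : T'.N = T.N.image σ
  edges : T'.E = T.E.image (Prod.map σ σ)
  zero : T'.h₀ = T.h₀.image σ
  hyperedges : T'.H = T.H.image (Finset.image σ)
  labels : ∀ x (hx : x ∈ T.N) (hx' : σ x ∈ T'.N), T'.L ⟨σ x, hx'⟩ = T.L ⟨x, hx⟩

section Dual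

variable {Ω : Type*} [MeasurableSpace Ω] (ℙ : Measure Ω) (d : ℕ) (α β γ : ℝ≥0)

/-- Families of coefficients `⟨f, T⟩`, where `T` runs through all Lions forests of the truncated
set. -/
abbrev Family : Type _ := ∀ T : Trunc d α β γ, Coeff ℙ d T.1.N T.1.H

variable {ℙ d α β γ}

/-- The family depends only on the isomorphism classes of Lions forests, which is how it becomes an
element `∑_T ⟨f, T⟩ · T` of the dual module `(𝓗^{γ,α,β})^†`, where `T` runs through non-planar
forests without names for their nodes. -/
def IsInvariant (f : Family ℙ d α β γ) : Prop :=
  ∀ (σ : Equiv.Perm ℕ) (T T' : Trunc d α β γ) (h : IsRelabelling σ T.1 T'.1),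
    ∀ᵐ ω ∂(prodMeasure ℙ T'.1.H), ∀ i : T'.1.N → Fin d,
      f T' ω i =
        f T (ω.1, fun p => ω.2 ⟨p.1.image σ, by
              rw [h.hyperedges]
              exact Finset.mem_image_of_mem _ p.2⟩)
          (fun x => i ⟨σ x.1, by
              rw [h.nodes]
              exact Finset.mem_image_of_mem _ x.2⟩)

/-- The counit `ε`: `⟨ε, 𝟏⟩ = 1` and `⟨ε, T⟩ = 0` for non-empty forests `T`. -/
def counit : Family ℙ d α β γ := fun T => if T.1.N = ∅ then 1 else 0

/-- The convolution product `⟨f ∗ g, T⟩ = ⟨f ⊗̃ g, Δ[T]⟩ = ∑ ⟨f, T_c^P⟩ ⊗^{H^T} ⟨g, T_c^R⟩`, where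
the sum is over all terms of the coproduct `Δ[T]`, the terms `T × 𝟏` and `𝟏 × T` included. -/
def conv [IsProbabilityMeasure ℙ] (f g : Family ℙ d α β γ) : Family ℙ d α β γ := fun T =>
  ∑ q ∈ T.1.cuts,
    coupledTensor (T.1.cut_coupling q) (T.1.cut_nodes q) (f (T.prune q)) (g (T.root q))

/-- Powers with respect to the convolution product. -/
def convPow [IsProbabilityMeasure ℙ] (f : Family ℙ d α β γ) : ℕ → Family ℙ d α β γ
  | 0 => counit
  | n + 1 => conv (convPow f n) f

/-- The antipode `𝓢[f] = ∑_{n ≥ 0} (ε - f)^{∗ n}`. If `⟨f, 𝟏⟩ = 1`, then only finitely many terms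
contribute to `⟨𝓢[f], T⟩`. -/
def antipode [IsProbabilityMeasure ℙ] (f : Family ℙ d α β γ) : Family ℙ d α β γ := fun T =>
  ∑ᶠ n : ℕ, convPow (counit - f) n T

/-- Characters: elements `f` of the dual module with `⟨f, 𝟏⟩ = 1` and
`⟨f, T₁ ⊛ T₂⟩ = ⟨f, T₁⟩ ⊗ ⟨f, T₂⟩` whenever `T₁ ⊛ T₂` is in the truncated set. The right-hand side
is `⟨f, T₁⟩(ω₀, ω_{H¹}) ⊗ ⟨f, T₂⟩(ω₀, ω_{H²})`. -/
structure IsCharacter [IsProbabilityMeasure ℙ] (f : Family ℙ d α β γ) : Prop where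
  invariant : IsInvariant f
  one : ∀ T : Trunc d α β γ, T.1.N = ∅ → f T = 1
  mul : ∀ (T₁ T₂ : Trunc d α β γ) (hd : Disjoint T₁.1.N T₂.1.N)
    (h : (T₁.1.mul T₂.1 hd).grade α β ≤ γ),
    f ⟨T₁.1.mul T₂.1 hd, h⟩ = coupledTensor (T₁.1.mul_coupling T₂.1 hd) rfl (f T₁) (f T₂)

/-- `⟨f, T⟩(ω_{h₀}, ω_H) = ⟨f, 𝓔[T]⟩(ω₀, ω_{h₀}, ω_H)` almost surely, for all `T` with `h₀ ≠ ∅`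
such that `T` and `𝓔[T]` are in the truncated set. -/
def IsEInvariant (f : Family ℙ d α β γ) : Prop :=
  ∀ (T : Trunc d α β γ) (hE : T.1.calE.grade α β ≤ γ) (h0 : T.1.h₀.Nonempty),
    ∀ᵐ ω ∂(prodMeasure ℙ T.1.calE.H),
      f T (ω.2 ⟨T.1.h₀, Finset.mem_erase.2 ⟨h0.ne_empty, Finset.mem_insert_self _ _⟩⟩,
          fun h => ω.2 ⟨h.1, T.1.mem_primed h.2⟩) =
        f ⟨T.1.calE, hE⟩ ω

/-- If `h₀ = ∅`, then `⟨f, T⟩(ω₀, ω_H)` is almost surely equal to a random variable which does not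
depend on the state `ω₀` of the tagged particle. -/
def IsUntagged (f : Family ℙ d α β γ) : Prop :=
  ∀ T : Trunc d α β γ, T.1.h₀ = ∅ →
    ∃ Y : (T.1.H → Ω) →ₘ[Measure.pi fun _ => ℙ] ((T.1.N → Fin d) → ℝ),
      ∀ᵐ ω ∂(prodMeasure ℙ T.1.H), f T ω = Y ω.2

end Dual

/-- The set of characters of the truncated coupled Hopf module. -/
abbrev Character {Ω : Type*} [MeasurableSpace Ω] (ℙ : Measure Ω) [IsProbabilityMeasure ℙ] (d : ℕ)
    (α β γ : ℝ≥0) : Type _ := {f : Family ℙ d α β γ // IsCharacter f}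

/-- McKean–Vlasov characters. -/
def IsMcKeanVlasov {Ω : Type*} [MeasurableSpace Ω] {ℙ : Measure Ω} [IsProbabilityMeasure ℙ]
    {d : ℕ} {α β γ : ℝ≥0} (f : Character ℙ d α β γ) : Prop :=
  IsEInvariant f.1 ∧ IsUntagged f.1

end Lions

end

noncomputable section

namespace Lions

/-! ### Sampling the variables of hyperedges -/

section Sampling

variable {Ω : Type*} [MeasurableSpace Ω] {ℙ : Measure Ω}

/-! A cut of a forest is the same thing as its set `R` of root nodes, and the sets which occur are
exactly those closed under taking parents (`LionsForest.sum_cuts`). Hence, almost surely, `⟨f ∗ g,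
T⟩` is the sum over such `R` of `f` on the forest induced on `N \ R` times `g` on the forest induced
on `R` (`conv_ae`). This is a convolution of incidence-algebra type over the lattice of
parent-closed sets: iterating it involves only differences `B \ A` of such sets, and a factor is a
sum over the sets between `A` and `B` (`conv_val_ae`).

To make iterated restrictions coherent, the variables are spread over the nodes: a node carries the
variable of its block, and an induced hyperedge reads off the variable of any of its nodes. Distinct
induced hyperedges lie in distinct blocks of `T`, so the variables they read are again independent
copies, and null sets pull back to null sets (`ae_reindex`, `ae_restrVar`). Almost sure identities
can then be treated as pointwise ones, finitely or countably many at a time.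

Associativity is a sum over chains `R ⊆ R'`. With `u = ε - f`, which vanishes on the empty forest,
each factor of a power of `u` uses up a node, so the series for the antipode is finite and
telescopes to a left inverse (`antipode_conv`). When `T` is a product, its parent-closed sets are
pairs of such sets in the two factors, so convolution preserves multiplicativity; for a left inverse
one argues by induction on the number of nodes (`IsMultiplicative.of_conv_eq_counit`).

Isomorphism invariance and `𝓔`-invariance both say that coefficients of two forests with the same
nodes and edges agree after a change of variables. Such agreement passes to convolutions once it
holds on all induced forests (`IsComparison.agrees_conv`). For `𝓔`, a cut may produce a part which
misses `h₀`; the two sides then evaluate the same coefficient at different tagged variables, and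
independence of `ω₀` is what makes them equal (`IsEInvariant.agreesOnSub`).

If `α ≤ β`, the hyperedge of a root of an untagged forest can be tagged without raising the grade.
`𝓔` undoes this, and `𝓔`-invariance then expresses the coefficient without `ω₀`
(`IsEInvariant.isUntagged`). -/

/-- The variables `ω₀` and `ω_h`, `h ∈ G`, as one family indexed by `Option G`. -/
def withTag {G : Finset (Finset ℕ)} (ω : Ω × (G → Ω)) : Option G → Ω := fun o => o.elim ω.1 ω.2

lemma measurable_withTag {G : Finset (Finset ℕ)} :
    Measurable (withTag : Ω × (G → Ω) → Option G → Ω) := by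
  refine measurable_pi_lambda _ fun o => ?_
  cases o with
  | none => exact measurable_fst
  | some g => exact (measurable_pi_apply g).comp measurable_snd

lemma measurePreserving_withTag [IsProbabilityMeasure ℙ] (G : Finset (Finset ℕ)) :
    MeasurePreserving (withTag : Ω × (G → Ω) → Option G → Ω) (prodMeasure ℙ G)
      (Measure.pi fun _ => ℙ) := by
  refine ⟨measurable_withTag, (Measure.pi_eq fun s hs => ?_).symm⟩
  rw [Measure.map_apply measurable_withTag (MeasurableSet.univ_pi hs)]
  have : withTag ⁻¹' (Set.univ.pi s) =
      s none ×ˢ (Set.univ.pi fun g : G => s (some g) : Set (G → Ω)) := by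
    ext ω
    simp only [Set.mem_preimage, Set.mem_pi, Set.mem_univ, forall_const, Set.mem_prod]
    constructor
    · exact fun h => ⟨h none, fun g => h (some g)⟩
    · rintro ⟨h, h'⟩ (_ | g)
      · exact h
      · exact h' g
  rw [this, Measure.prod_prod, Measure.pi_pi, Fintype.prod_option]

/-- The coordinates of a product measure are independent with law `ℙ`, and an injective choice among
them stays independent. Injectivity matters: a repeated coordinate would put the image law on a
diagonal. -/
lemma measurePreserving_comp_injective [IsProbabilityMeasure ℙ] {ι κ : Type*} [Fintype ι]
    [Fintype κ] (φ : κ → ι) (hφ : Function.Injective φ) :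
    MeasurePreserving (fun (ω : ι → Ω) k => ω (φ k)) (Measure.pi fun _ => ℙ)
      (Measure.pi fun _ => ℙ) := by
  have hm : Measurable fun (ω : ι → Ω) k => ω (φ k) := by fun_prop
  refine ⟨hm, ?_⟩
  have h := (ProbabilityTheory.iIndepFun_pi (μ := fun _ : ι => ℙ) (X := fun _ => id)
    fun _ => aemeasurable_id).precomp hφ
  refine ((ProbabilityTheory.iIndepFun_iff_map_fun_eq_pi_map (f := fun k (ω : ι → Ω) => ω (φ k))
    fun k => (measurable_pi_apply (φ k)).aemeasurable).1 h).trans ?_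
  congr 1
  funext k
  exact (measurePreserving_eval (fun _ : ι => ℙ) (φ k)).map_eq

/-- Choosing distinct variables out of `ω₀` and `ω_G` yields independent copies. -/
lemma measurePreserving_reindex [IsProbabilityMeasure ℙ] {P G : Finset (Finset ℕ)}
    (φ : Option P → Option G) (hφ : Function.Injective φ) :
    MeasurePreserving
      (fun ω : Ω × (G → Ω) => (withTag ω (φ none), fun p : P => withTag ω (φ (some p))))
      (prodMeasure ℙ G) (prodMeasure ℙ P) := by
  have hu : Measurable fun ω : Option P → Ω => (ω none, fun p : P => ω (some p)) := by fun_prop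
  have h1 : MeasurePreserving (fun ω : Option P → Ω => (ω none, fun p : P => ω (some p)))
      (Measure.pi fun _ => ℙ) (prodMeasure ℙ P) := by
    refine ⟨hu, ?_⟩
    rw [← (measurePreserving_withTag (ℙ := ℙ) P).map_eq, Measure.map_map hu measurable_withTag]
    exact Measure.map_id
  exact h1.comp ((measurePreserving_comp_injective φ hφ).comp (measurePreserving_withTag G))

end Sampling

/-- A representative of a non-empty set of nodes. -/
def rep (p : Finset ℕ) : ℕ := sInf (p : Set ℕ)

lemma rep_mem {p : Finset ℕ} (hp : p.Nonempty) : rep p ∈ p := Nat.sInf_mem (s := (p : Set ℕ)) hp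

section Spread

variable {Ω : Type*}

open Classical in
/-- The variable which belongs to a node: `ω_g` for the nodes of `g ∈ G`, and `ω₀` for the
remaining nodes. -/
def spread (G : Finset (Finset ℕ)) (ω : Ω × (G → Ω)) (x : ℕ) : Ω :=
  if h : ∃ g ∈ G, x ∈ g then ω.2 ⟨h.choose, h.choose_spec.1⟩ else ω.1

lemma IsPartition.eq_of_mem {G : Finset (Finset ℕ)} {S : Finset ℕ} (hG : IsPartition G S)
    {g g' : Finset ℕ} (hg : g ∈ G) (hg' : g' ∈ G) {x : ℕ} (hx : x ∈ g) (hx' : x ∈ g') :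
    g = g' := by
  by_contra h
  exact Finset.disjoint_left.1 (hG.disjoint g hg g' hg' h) hx hx'

lemma spread_eq {G : Finset (Finset ℕ)} {S : Finset ℕ} (hG : IsPartition G S)
    (ω : Ω × (G → Ω)) {g : Finset ℕ} (hg : g ∈ G) {x : ℕ} (hx : x ∈ g) :
    spread G ω x = ω.2 ⟨g, hg⟩ := by
  have h : ∃ g ∈ G, x ∈ g := ⟨g, hg, hx⟩
  rw [spread, dif_pos h]
  have : h.choose = g := hG.eq_of_mem h.choose_spec.1 hg h.choose_spec.2 hx
  exact congrArg ω.2 (Subtype.ext this)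

variable [MeasurableSpace Ω] {ℙ : Measure Ω}

lemma measurable_spread (G : Finset (Finset ℕ)) (x : ℕ) :
    Measurable fun ω : Ω × (G → Ω) => spread G ω x := by
  by_cases h : ∃ g ∈ G, x ∈ g
  · simp only [spread, dif_pos h]
    fun_prop
  · simp only [spread, dif_neg h]
    fun_prop

/-- If the representatives of the elements of `P` lie in distinct blocks of `G`, and `o` is the
variable of yet another block (or `ω₀`), then these variables are independent copies. -/
lemma ae_reindex [IsProbabilityMeasure ℙ] {P G : Finset (Finset ℕ)} {S : Finset ℕ}
    (hG : IsPartition G S) (k : Option G) (b : P → G) (hb : Function.Injective b)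
    (hk : ∀ p, some (b p) ≠ k) (r : P → ℕ) (hr : ∀ p, r p ∈ (b p).1)
    {Q : Ω × (P → Ω) → Prop} (h : ∀ᵐ ω ∂prodMeasure ℙ P, Q ω) :
    ∀ᵐ ω ∂prodMeasure ℙ G, Q (withTag ω k, fun p => spread G ω (r p)) := by
  have hφ : Function.Injective fun o : Option P => o.elim k fun p => some (b p) := by
    rintro (_ | p) (_ | p') hpp
    · rfl
    · exact absurd hpp.symm (hk p')
    · exact absurd hpp (hk p)
    · exact congrArg some (hb (Option.some.inj hpp))
  have := (measurePreserving_reindex (ℙ := ℙ) _ hφ).quasiMeasurePreserving.ae h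
  filter_upwards [this] with ω hω
  have e : (fun p => spread G ω (r p)) = fun p => ω.2 (b p) :=
    funext fun p => spread_eq hG ω (b p).2 (hr p)
  rw [e]
  exact hω

end Spread

/-! ### Induced forests -/

/-- `A` is a path-convex set of nodes of `T`. -/
def LionsForest.Convex {d : ℕ} (T : LionsForest d) (A : Finset ℕ) : Prop :=
  A ⊆ T.N ∧ PathConvex T.E A

open Classical in
/-- The forest induced on a path-convex set of nodes; it is `T` itself for other sets. -/
def LionsForest.sub {d : ℕ} (T : LionsForest d) (A : Finset ℕ) : LionsForest d :=
  if h : T.Convex A then T.restrict A h.1 h.2 else T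

section Sub

variable {d : ℕ} {T : LionsForest d} {A B : Finset ℕ}

lemma LionsForest.sub_eq_restrict (h : T.Convex A) : T.sub A = T.restrict A h.1 h.2 := dif_pos h

lemma LionsForest.sub_eq_self (h : ¬ T.Convex A) : T.sub A = T := dif_neg h

lemma LionsForest.sub_N (h : T.Convex A) : (T.sub A).N = A := by
  rw [LionsForest.sub_eq_restrict h]; rfl

lemma LionsForest.sub_E (h : T.Convex A) : (T.sub A).E = restrictE T.E A := by
  rw [LionsForest.sub_eq_restrict h]; rfl

lemma LionsForest.sub_h₀ (h : T.Convex A) : (T.sub A).h₀ = T.h₀ ∩ A := by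
  rw [LionsForest.sub_eq_restrict h]; rfl

lemma LionsForest.sub_H (h : T.Convex A) : (T.sub A).H = trace T.H A := by
  rw [LionsForest.sub_eq_restrict h]; rfl

-- This holds without convexity thanks to the default value of `sub`, so tensor legs can be
-- restricted to `A` with no side condition.
variable (T A) in
lemma LionsForest.sub_N_subset : (T.sub A).N ⊆ T.N := by
  by_cases h : T.Convex A
  · rw [LionsForest.sub_N h]; exact h.1
  · rw [LionsForest.sub_eq_self h]

lemma mem_trace {G : Finset (Finset ℕ)} {p : Finset ℕ} :
    p ∈ trace G A ↔ p.Nonempty ∧ ∃ g ∈ G, g ∩ A = p := by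
  simp [trace, Finset.nonempty_iff_ne_empty]

lemma trace_trace (G : Finset (Finset ℕ)) (h : B ⊆ A) : trace (trace G A) B = trace G B := by
  have e : ∀ g : Finset ℕ, g ∩ A ∩ B = g ∩ B := fun g => by
    rw [Finset.inter_assoc, Finset.inter_eq_right.2 h]
  ext p
  simp only [mem_trace]
  constructor
  · rintro ⟨hp, _, ⟨_, g, hg, rfl⟩, rfl⟩
    exact ⟨hp, g, hg, (e g).symm⟩
  · rintro ⟨hp, g, hg, rfl⟩
    refine ⟨hp, g ∩ A, ⟨?_, g, hg, rfl⟩, e g⟩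
    obtain ⟨x, hx⟩ := hp
    rw [Finset.mem_inter] at hx
    exact ⟨x, Finset.mem_inter.2 ⟨hx.1, h hx.2⟩⟩

lemma trace_self {G : Finset (Finset ℕ)} {S : Finset ℕ} (hG : IsPartition G S) (h : S ⊆ A) :
    trace G A = G := by
  have := trace_eq_self (G' := ∅) hG h (by simp)
  rwa [Finset.union_empty] at this

lemma restrictE_restrictE (E : Finset (ℕ × ℕ)) (h : B ⊆ A) :
    restrictE (restrictE E A) B = restrictE E B := by
  ext ⟨x, y⟩
  simp only [mem_restrictE]
  exact ⟨fun ⟨⟨a, _⟩, b⟩ => ⟨a, b⟩, fun ⟨a, b⟩ => ⟨⟨a, h b.1, h b.2⟩, b⟩⟩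

lemma below_of_restrictE {E : Finset (ℕ × ℕ)} {x y : ℕ} (h : Below (restrictE E A) x y) :
    Below E x y := by
  induction h with
  | refl => exact Relation.ReflTransGen.refl
  | tail _ hbc ih => exact Relation.ReflTransGen.tail ih (mem_restrictE.1 hbc).1

/-- Every path of the induced forest is a path of `T`. -/
lemma LionsForest.convex_sub (hA : T.Convex A) (hB : T.Convex B) (h : B ⊆ A) :
    (T.sub A).Convex B := by
  refine ⟨by rwa [sub_N hA], fun x hx z hz y hxy hyz => ?_⟩
  rw [sub_E hA] at hxy hyz
  exact hB.2 x hx z hz y (below_of_restrictE hxy) (below_of_restrictE hyz)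

lemma LionsForest.sub_sub (hA : T.Convex A) (hB : T.Convex B) (h : B ⊆ A) :
    (T.sub A).sub B = T.sub B := by
  have h1 := convex_sub hA hB h
  rw [sub_eq_restrict h1, sub_eq_restrict hB]
  have h2 : A ∩ B = B := Finset.inter_eq_right.2 h
  -- The domain of the labels depends on the forest, so `T.sub A` is replaced by a variable forest
  -- that can be substituted away.
  have eL : ∀ (T' : LionsForest d) (_ : T' = T.restrict A hA.1 hA.2) (h3 : B ⊆ T'.N),
      (fun x : B => T'.L ⟨x.1, h3 x.2⟩) = fun x : B => T.L ⟨x.1, hB.1 x.2⟩ := by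
    rintro _ rfl _
    rfl
  refine LionsForest.ext rfl ?_ ?_ ?_ (heq_of_eq (eL _ (sub_eq_restrict hA) h1.1))
  · change restrictE (T.sub A).E B = restrictE T.E B
    rw [sub_E hA, restrictE_restrictE _ h]
  · change (T.sub A).h₀ ∩ B = T.h₀ ∩ B
    rw [sub_h₀ hA, Finset.inter_assoc, h2]
  · change trace (T.sub A).H B = trace T.H B
    rw [sub_H hA, trace_trace _ h]

variable (T) in
lemma LionsForest.convex_univ : T.Convex T.N :=
  ⟨subset_rfl, fun _ hx _ _ _ hxy _ => T.mem_N_of_below hxy hx⟩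

variable (T) in
lemma LionsForest.sub_self : T.sub T.N = T := by
  rw [sub_eq_restrict T.convex_univ]
  refine LionsForest.ext rfl ?_ ?_ ?_ HEq.rfl
  · exact Finset.filter_true_of_mem fun e he => T.E_subset e.1 e.2 he
  · exact Finset.inter_eq_left.2 T.h₀_subset
  · exact trace_self T.H_partition Finset.sdiff_subset

/-! ### Cuts as sets of nodes which are closed under taking parents -/

/-- The sets of nodes which contain the parents of their elements. -/
def LionsForest.ups {d : ℕ} (T : LionsForest d) : Finset (Finset ℕ) :=
  T.N.powerset.filter fun R => ∀ e ∈ T.E, e.1 ∈ R → e.2 ∈ R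

lemma LionsForest.mem_ups : A ∈ T.ups ↔ A ⊆ T.N ∧ ∀ x y, (x, y) ∈ T.E → x ∈ A → y ∈ A := by
  simp only [ups, Finset.mem_filter, Finset.mem_powerset, Prod.forall]

lemma LionsForest.mem_of_below (hA : A ∈ T.ups) {x y : ℕ} (h : Below T.E x y) (hx : x ∈ A) :
    y ∈ A := by
  induction h with
  | refl => exact hx
  | tail _ hbc ih => exact (mem_ups.1 hA).2 _ _ hbc ih

/-- A path that starts in `B` stays in `B`, and one that has entered `A` never leaves it. These
differences are all the node sets that iterated cutting produces. -/
lemma LionsForest.convex_sdiff (hA : A ∈ T.ups) (hB : B ∈ T.ups) : T.Convex (B \ A) := by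
  refine ⟨fun x hx => (mem_ups.1 hB).1 (Finset.mem_sdiff.1 hx).1, fun x hx z hz y hxy hyz => ?_⟩
  rw [Finset.mem_sdiff] at hx hz ⊢
  exact ⟨mem_of_below hB hxy hx.1, fun hy => hz.2 (mem_of_below hA hyz hy)⟩

variable (T) in
lemma LionsForest.empty_mem_ups : ∅ ∈ T.ups := by simp [mem_ups]

variable (T) in
lemma LionsForest.univ_mem_ups : T.N ∈ T.ups :=
  mem_ups.2 ⟨subset_rfl, fun x y h _ => (T.E_subset x y h).2⟩

lemma LionsForest.convex_of_mem_ups (hA : A ∈ T.ups) : T.Convex A := by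
  simpa using convex_sdiff T.empty_mem_ups hA

lemma LionsForest.convex_compl (hA : A ∈ T.ups) : T.Convex (T.N \ A) :=
  convex_sdiff hA T.univ_mem_ups

lemma LionsForest.rootNodes_mem_ups (q : Finset (ℕ × ℕ) × Finset ℕ) : T.rootNodes q ∈ T.ups := by
  classical
  refine mem_ups.2 ⟨Finset.filter_subset _ _, fun x y hxy hx => ?_⟩
  simp only [rootNodes, Finset.mem_filter] at hx ⊢
  exact ⟨(T.E_subset x y hxy).2, fun e he h => hx.2.1 e he (Relation.ReflTransGen.head hxy h),
    fun r hr h => hx.2.2 r hr (Relation.ReflTransGen.head hxy h)⟩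

/-- The cut whose root has the nodes `R`. -/
def LionsForest.cutOf {d : ℕ} (T : LionsForest d) (R : Finset ℕ) :
    Finset (ℕ × ℕ) × Finset ℕ :=
  (T.E.filter fun e => e.1 ∉ R ∧ e.2 ∈ R, T.roots \ R)

lemma LionsForest.mem_cutOf_fst {R : Finset ℕ} {e : ℕ × ℕ} :
    e ∈ (T.cutOf R).1 ↔ e ∈ T.E ∧ e.1 ∉ R ∧ e.2 ∈ R := by
  simp [cutOf]

lemma LionsForest.mem_cutOf_snd {R : Finset ℕ} {x : ℕ} :
    x ∈ (T.cutOf R).2 ↔ x ∈ T.roots ∧ x ∉ R := by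
  simp [cutOf]

lemma LionsForest.mem_roots {x : ℕ} : x ∈ T.roots ↔ x ∈ T.N ∧ ∀ y, (x, y) ∉ T.E := by
  simp only [roots, Finset.mem_filter, and_congr_right_iff]
  intro _
  exact ⟨fun h y hy => h _ hy rfl, fun h e he hx => h e.2 (hx ▸ he)⟩

lemma LionsForest.eq_of_below_root {x y : ℕ} (hx : x ∈ T.roots) (h : Below T.E x y) : x = y := by
  rcases Relation.ReflTransGen.cases_head h with e | ⟨w, hw, _⟩
  · exact e
  · exact absurd hw ((mem_roots.1 hx).2 w)

/-- The cut edges on a path are determined by the node where the path enters `R`. -/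
lemma LionsForest.eq_of_enter {R : Finset ℕ} (hR : R ∈ T.ups) {y a b a' b' : ℕ}
    (h : Below T.E y a) (hab : (a, b) ∈ T.E) (ha : a ∉ R) (hb : b ∈ R)
    (h' : Below T.E y a') (hab' : (a', b') ∈ T.E) (ha' : a' ∉ R) (hb' : b' ∈ R) :
    a = a' := by
  induction h using Relation.ReflTransGen.head_induction_on with
  | refl =>
    rcases Relation.ReflTransGen.cases_head h' with e | ⟨w, hw, hwa⟩
    · exact e
    · have : b = w := T.E_functional a b w hab hw
      exact absurd (mem_of_below hR hwa (this ▸ hb)) ha'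
  | @head c w hcw hwa ih =>
    rcases Relation.ReflTransGen.cases_head h' with e | ⟨v, hv, hva⟩
    · subst e
      have : b' = w := T.E_functional _ b' w hab' hcw
      exact absurd (mem_of_below hR hwa (this ▸ hb')) ha
    · exact ih (T.E_functional _ v w hv hcw ▸ hva)

/-- A path that has entered the parent-closed set `R` remains there, so it crosses the boundary at
most once and, having crossed, cannot end at a root outside `R`. -/
lemma LionsForest.isCut_cutOf {R : Finset ℕ} (hR : R ∈ T.ups) :
    T.IsCut (T.cutOf R).1 (T.cutOf R).2 := by
  refine ⟨Finset.filter_subset _ _, Finset.sdiff_subset, ?_, ?_⟩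
  · rintro y _ ⟨a, b⟩ he ⟨a', b'⟩ he' h h'
    rw [mem_cutOf_fst] at he he'
    have := eq_of_enter hR h he.1 he.2.1 he.2.2 h' he'.1 he'.2.1 he'.2.2
    subst this
    rw [T.E_functional a b b' he.1 he'.1]
  · rintro y _ ⟨a, b⟩ he r hr h h'
    rw [mem_cutOf_fst] at he
    rw [mem_cutOf_snd] at hr
    have key : Below T.E a r ∨ Below T.E r a := by
      clear he
      induction h using Relation.ReflTransGen.head_induction_on with
      | refl => exact Or.inl h'
      | @head c w hcw hwa ih =>
        rcases Relation.ReflTransGen.cases_head h' with e | ⟨v, hv, hvr⟩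
        · subst e
          exact absurd hcw ((mem_roots.1 hr.1).2 w)
        · exact ih (T.mem_N_of_below (Relation.ReflTransGen.single hcw) ‹_›)
            (T.E_functional _ v w hv hcw ▸ hvr)
    rcases key with h | h
    · rcases Relation.ReflTransGen.cases_head h with e | ⟨w, hw, hwr⟩
      · exact (mem_roots.1 hr.1).2 b (e ▸ he.1)
      · have : b = w := T.E_functional a b w he.1 hw
        exact hr.2 (mem_of_below hR hwr (this ▸ he.2.2))
    · have := eq_of_below_root hr.1 h
      exact (mem_roots.1 hr.1).2 b (this ▸ he.1)

/-- Walk up from `x`: either the path enters `R`, through a cut edge, or it ends at a root outside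
`R`, which is pruned. The induction on the depth makes the walk finite. -/
lemma LionsForest.exists_enter {R : Finset ℕ} : ∀ n x, depth T.E x = n → x ∈ T.N → x ∉ R →
    (∃ e ∈ (T.cutOf R).1, Below T.E x e.1) ∨ ∃ r ∈ (T.cutOf R).2, Below T.E x r := by
  intro n
  induction n with
  | zero =>
    intro x hx
    have := one_le_depth T.E x
    omega
  | succ n ih =>
    intro x hx hxN hxR
    by_cases h : ∃ y, (x, y) ∈ T.E
    · obtain ⟨y, hy⟩ := h
      by_cases hyR : y ∈ R
      · exact Or.inl ⟨(x, y), mem_cutOf_fst.2 ⟨hy, hxR, hyR⟩, Relation.ReflTransGen.refl⟩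
      · have := depth_of_edge T.E_functional T.E_acyclic hy
        rcases ih y (by omega) (T.E_subset x y hy).2 hyR with ⟨e, he, h⟩ | ⟨r, hr, h⟩
        · exact Or.inl ⟨e, he, Relation.ReflTransGen.head hy h⟩
        · exact Or.inr ⟨r, hr, Relation.ReflTransGen.head hy h⟩
    · push Not at h
      exact Or.inr ⟨x, mem_cutOf_snd.2 ⟨mem_roots.2 ⟨hxN, h⟩, hxR⟩, Relation.ReflTransGen.refl⟩

lemma LionsForest.rootNodes_cutOf {R : Finset ℕ} (hR : R ∈ T.ups) :
    T.rootNodes (T.cutOf R) = R := by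
  classical
  ext x
  simp only [rootNodes, Finset.mem_filter]
  constructor
  · rintro ⟨hx, h1, h2⟩
    by_contra hxR
    rcases exists_enter _ x rfl hx hxR with ⟨e, he, h⟩ | ⟨r, hr, h⟩
    · exact h1 e he h
    · exact h2 r hr h
  · intro hx
    refine ⟨(mem_ups.1 hR).1 hx, fun e he h => ?_, fun r hr h => ?_⟩
    · exact (mem_cutOf_fst.1 he).2.1 (mem_of_below hR h hx)
    · exact (mem_cutOf_snd.1 hr).2 (mem_of_below hR h hx)

/-- The conditions `edge_unique` and `edge_root` ensure that nothing above the head of a cut edge is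
cut again. The head therefore lies in the root part, and the cut edges are exactly the boundary
edges of that part. -/
lemma LionsForest.cutOf_rootNodes {q : Finset (ℕ × ℕ) × Finset ℕ} (hq : T.IsCut q.1 q.2) :
    T.cutOf (T.rootNodes q) = q := by
  classical
  have hR : ∀ x, x ∈ T.rootNodes q ↔
      x ∈ T.N ∧ (∀ e ∈ q.1, ¬ Below T.E x e.1) ∧ ∀ r ∈ q.2, ¬ Below T.E x r := by
    intro x
    simp only [rootNodes, Finset.mem_filter]
  have hup := rootNodes_mem_ups (T := T) q
  refine Prod.ext ?_ ?_
  · ext ⟨x, y⟩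
    rw [mem_cutOf_fst]
    constructor
    · rintro ⟨hxy, hx, hy⟩
      have hyR := (hR y).1 hy
      have hxN := (T.E_subset x y hxy).1
      simp only [hR, hxN, true_and, not_and_or, not_forall, not_not, exists_prop] at hx
      rcases hx with ⟨⟨a, b⟩, he, h⟩ | ⟨r, hr, h⟩
      · rcases Relation.ReflTransGen.cases_head h with e | ⟨w, hw, hwa⟩
        · simp only at e
          subst e
          rw [T.E_functional x y b hxy (hq.edges he)]
          exact he
        · have : y = w := T.E_functional x y w hxy hw
          exact absurd (this ▸ hwa) (hyR.2.1 _ he)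
      · rcases Relation.ReflTransGen.cases_head h with e | ⟨w, hw, hwa⟩
        · subst e
          exact absurd hxy ((mem_roots.1 (hq.roots hr)).2 y)
        · have : y = w := T.E_functional x y w hxy hw
          exact absurd (this ▸ hwa) (hyR.2.2 _ hr)
    · intro he
      have hxy := hq.edges he
      have hN := T.E_subset x y hxy
      refine ⟨hxy, fun hx => ((hR x).1 hx).2.1 _ he Relation.ReflTransGen.refl,
        (hR y).2 ⟨hN.2, fun e' he' h => ?_, fun r hr h => ?_⟩⟩
      · have := hq.edge_unique x hN.1 _ he _ he' Relation.ReflTransGen.refl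
          (Relation.ReflTransGen.head hxy h)
        subst this
        exact T.E_acyclic x (Relation.TransGen.head' hxy h)
      · exact hq.edge_root x hN.1 _ he r hr Relation.ReflTransGen.refl
          (Relation.ReflTransGen.head hxy h)
  · ext x
    rw [mem_cutOf_snd]
    constructor
    · rintro ⟨hx, hxR⟩
      have hxN := (mem_roots.1 hx).1
      simp only [hR, hxN, true_and, not_and_or, not_forall, not_not, exists_prop] at hxR
      rcases hxR with ⟨⟨a, b⟩, he, h⟩ | ⟨r, hr, h⟩
      · have := eq_of_below_root hx h
        simp only at this
        exact absurd (hq.edges (this ▸ he)) ((mem_roots.1 hx).2 b)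
      · rwa [eq_of_below_root hx h]
    · intro hx
      exact ⟨hq.roots hx, fun h => ((hR x).1 h).2.2 x hx Relation.ReflTransGen.refl⟩

lemma LionsForest.mem_cuts {q : Finset (ℕ × ℕ) × Finset ℕ} : q ∈ T.cuts ↔ T.IsCut q.1 q.2 := by
  simp only [cuts, Finset.mem_filter, Finset.mem_product, Finset.mem_powerset,
    and_iff_right_iff_imp]
  exact fun h => ⟨h.edges, h.roots⟩

-- The bijection between cuts and parent-closed sets; from here on convolutions are sums over
-- `T.ups`.
variable (T) in
lemma LionsForest.sum_cuts {M : Type*} [AddCommMonoid M] (F : Finset ℕ → M) :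
    ∑ q ∈ T.cuts, F (T.rootNodes q) = ∑ R ∈ T.ups, F R :=
  Finset.sum_bij' (fun q _ => T.rootNodes q) (fun R _ => T.cutOf R)
    (fun q _ => rootNodes_mem_ups q) (fun _ hR => mem_cuts.2 (isCut_cutOf hR))
    (fun _ hq => cutOf_rootNodes (mem_cuts.1 hq)) (fun _ hR => rootNodes_cutOf hR)
    (fun _ _ => rfl)

/-- The parent-closed sets of nodes of a difference of two parent-closed sets. -/
lemma LionsForest.mem_ups_sub_sdiff {C : Finset ℕ} (hA : A ∈ T.ups) (hB : B ∈ T.ups) :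
    C ∈ (T.sub (B \ A)).ups ↔ C ⊆ B \ A ∧ A ∪ C ∈ T.ups := by
  have h := convex_sdiff hA hB
  rw [mem_ups, sub_N h, sub_E h, and_congr_right_iff]
  intro hC
  constructor
  · refine fun hc => mem_ups.2 ⟨Finset.union_subset (mem_ups.1 hA).1 (hC.trans h.1), ?_⟩
    intro x y hxy hx
    rw [Finset.mem_union] at hx ⊢
    rcases hx with hx | hx
    · exact Or.inl ((mem_ups.1 hA).2 x y hxy hx)
    · by_cases hy : y ∈ A
      · exact Or.inl hy
      · have hxB := hC hx
        exact Or.inr (hc x y (mem_restrictE.2 ⟨hxy, hxB, Finset.mem_sdiff.2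
          ⟨(mem_ups.1 hB).2 x y hxy (Finset.mem_sdiff.1 hxB).1, hy⟩⟩) hx)
  · intro hc x y hxy hx
    have hxy' := mem_restrictE.1 hxy
    have := (mem_ups.1 hc).2 x y hxy'.1 (Finset.mem_union_right _ hx)
    exact (Finset.mem_union.1 this).resolve_left (Finset.mem_sdiff.1 hxy'.2.2).2

lemma LionsForest.union_mem_ups (hA : A ∈ T.ups) (hB : B ∈ T.ups) : A ∪ B ∈ T.ups := by
  rw [mem_ups] at *
  refine ⟨Finset.union_subset hA.1 hB.1, fun x y hxy hx => ?_⟩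
  rw [Finset.mem_union] at *
  exact hx.imp (hA.2 x y hxy) (hB.2 x y hxy)

lemma LionsForest.inter_mem_ups (hA : A ∈ T.ups) (hB : B ∈ T.ups) : A ∩ B ∈ T.ups := by
  rw [mem_ups] at *
  refine ⟨fun x hx => hA.1 (Finset.mem_inter.1 hx).1, fun x y hxy hx => ?_⟩
  rw [Finset.mem_inter] at *
  exact ⟨hA.2 x y hxy hx.1, hB.2 x y hxy hx.2⟩

end Sub

/-! ### Pointwise evaluation of the coefficients of induced forests -/

/-- The induced forest, in the truncated set. -/
def Trunc.sub {d : ℕ} {α β γ : ℝ≥0} (T : Trunc d α β γ) (A : Finset ℕ) : Trunc d α β γ :=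
  ⟨T.1.sub A, by
    by_cases h : T.1.Convex A
    · rw [LionsForest.sub_eq_restrict h]
      exact (T.1.grade_restrict α β _ _ _).trans T.2
    · rw [LionsForest.sub_eq_self h]
      exact T.2⟩

section Eval

variable {Ω : Type*} {d : ℕ}

/-- The variables of an induced forest: every hyperedge uses the variable of the hyperedge it
comes from. -/
def restrVar (T : LionsForest d) (A : Finset ℕ) (ω : Ω × (T.H → Ω)) : Ω × ((T.sub A).H → Ω) :=
  (ω.1, fun p => spread T.H ω (rep p.1))

/-- The tensor legs of an induced forest. -/
def restrLeg (T : LionsForest d) (A : Finset ℕ) (i : T.N → Fin d) : (T.sub A).N → Fin d :=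
  fun x => i ⟨x.1, T.sub_N_subset A x.2⟩

lemma LionsForest.nonempty_of_mem_H (T : LionsForest d) {p : Finset ℕ} (hp : p ∈ T.H) :
    p.Nonempty :=
  Finset.nonempty_iff_ne_empty.2 fun h => T.H_partition.empty_notMem (h ▸ hp)

variable {T : LionsForest d} {A B : Finset ℕ}

/-- The hyperedges of an induced forest come from distinct hyperedges of the forest. -/
lemma LionsForest.exists_block (T : LionsForest d) (A : Finset ℕ) :
    ∃ b : (T.sub A).H → T.H, Function.Injective b ∧ ∀ p, p.1 ⊆ (b p).1 := by
  by_cases h : T.Convex A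
  · have key : ∀ p : (T.sub A).H, ∃ g : T.H, g.1 ∩ A = p.1 := by
      rintro ⟨p, hp⟩
      rw [sub_H h, mem_trace] at hp
      obtain ⟨_, g, hg, e⟩ := hp
      exact ⟨⟨g, hg⟩, e⟩
    choose b hb using key
    refine ⟨b, fun p p' hpp => Subtype.ext ?_, fun p => ?_⟩
    · rw [← hb p, ← hb p', hpp]
    · rw [← hb p]
      exact Finset.inter_subset_left
  · rw [sub_eq_self h]
    exact ⟨id, Function.injective_id, fun _ => subset_rfl⟩

/-- An induced hyperedge lies inside one block of `T`, so the choice of representative is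
immaterial. -/
lemma spread_rep_eq (ω : Ω × (T.H → Ω)) {p : Finset ℕ} (hp : p ∈ (T.sub A).H) {x : ℕ}
    (hx : x ∈ p) : spread T.H ω (rep p) = spread T.H ω x := by
  obtain ⟨b, _, hb⟩ := T.exists_block A
  have hs := hb ⟨p, hp⟩
  rw [spread_eq T.H_partition ω (b ⟨p, hp⟩).2 (hs (rep_mem ((T.sub A).nonempty_of_mem_H hp))),
    spread_eq T.H_partition ω (b ⟨p, hp⟩).2 (hs hx)]

/-- A node covered by an induced hyperedge carries the same variable in the induced forest as in
`T`. This is what makes restricting twice the same as restricting once. -/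
lemma spread_restrVar (ω : Ω × (T.H → Ω)) {p : Finset ℕ} (hp : p ∈ (T.sub A).H) {x : ℕ}
    (hx : x ∈ p) : spread (T.sub A).H (restrVar T A ω) x = spread T.H ω x := by
  rw [spread_eq (T.sub A).H_partition _ hp hx, ← spread_rep_eq ω hp hx, restrVar]

lemma psi_spec {M : Finset ℕ} {P G : Finset (Finset ℕ)} (h : trace G M = P) (p : P) :
    (psi h p).1 ∩ M = p.1 := by
  have hp : ∃ g ∈ G, g ∩ M = p.1 := by
    have h1 : p.1 ∈ trace G M := h ▸ p.2
    simpa using Finset.mem_image.1 (Finset.mem_of_mem_erase h1)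
  exact hp.choose_spec.2

/-- Replaces the block chosen by `psi` in the coupled tensor product by the variable of a node,
which no longer refers to the coupling. -/
lemma spread_psi {M S : Finset ℕ} {P G : Finset (Finset ℕ)} (hG : IsPartition G S)
    (h : trace G M = P) (p : P) (ω : Ω × (G → Ω)) :
    ω.2 (psi h p) = spread G ω (rep p.1) := by
  have hp : p.1.Nonempty := (mem_trace.1 (h.symm.subset p.2)).1
  have h1 : rep p.1 ∈ (psi h p).1 := by
    have := rep_mem hp
    rw [← psi_spec h p] at this ⊢
    exact (Finset.mem_inter.1 this).1
  exact (spread_eq hG ω (psi h p).2 h1).symm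

end Eval

section Values

variable {Ω : Type*} [MeasurableSpace Ω] {ℙ : Measure Ω} {d : ℕ} {α β γ : ℝ≥0}

/-- The value of the coefficient of the forest induced by `T` on `A`, as a function of the variables
and tensor legs of `T`. -/
def val (f : Family ℙ d α β γ) (T : Trunc d α β γ) (A : Finset ℕ) (ω : Ω × (T.1.H → Ω))
    (i : T.1.N → Fin d) : ℝ :=
  f (T.sub A) (restrVar T.1 A ω) (restrLeg T.1 A i)

variable {T : Trunc d α β γ} {A B : Finset ℕ}

/-- Coefficients of propositionally equal forests live in different types. Giving the variables by
functions on `ℕ` and the legs by a function on a common set `K` lets the equality be substituted, so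
no casts appear later. -/
lemma eval_congr (f : Family ℙ d α β γ) {S S' : Trunc d α β γ} (h : S = S') {K : Finset ℕ}
    (hS : S.1.N ⊆ K) (hS' : S'.1.N ⊆ K) (o : Ω) (w w' : ℕ → Ω)
    (hw : ∀ p ∈ S.1.H, w (rep p) = w' (rep p)) (i : K → Fin d) :
    f S (o, fun p => w (rep p.1)) (fun x => i ⟨x.1, hS x.2⟩) =
      f S' (o, fun p => w' (rep p.1)) (fun x => i ⟨x.1, hS' x.2⟩) := by
  subst h
  have e : (fun p : S.1.H => w (rep p.1)) = fun p => w' (rep p.1) :=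
    funext fun p => hw p.1 p.2
  rw [e]

lemma Trunc.sub_sub (hA : T.1.Convex A) (hB : T.1.Convex B) (h : B ⊆ A) :
    (T.sub A).sub B = T.sub B :=
  Subtype.ext (LionsForest.sub_sub hA hB h)

lemma val_sub (f : Family ℙ d α β γ) (hA : T.1.Convex A) (hB : T.1.Convex B) (h : B ⊆ A)
    (ω : Ω × (T.1.H → Ω)) (i : T.1.N → Fin d) :
    val f (T.sub A) B (restrVar T.1 A ω) (restrLeg T.1 A i) = val f T B ω i := by
  refine eval_congr f (Trunc.sub_sub hA hB h) (K := T.1.N)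
    (((T.1.sub A).sub_N_subset B).trans (T.1.sub_N_subset A)) (T.1.sub_N_subset B) ω.1
    (spread (T.1.sub A).H (restrVar T.1 A ω)) (spread T.1.H ω) (fun p hp => ?_) i
  obtain ⟨b, _, hb⟩ := (T.1.sub A).exists_block B
  exact spread_restrVar ω (b ⟨p, hp⟩).2
    (hb ⟨p, hp⟩ (rep_mem (((T.1.sub A).sub B).nonempty_of_mem_H hp)))

lemma eval_eq (f : Family ℙ d α β γ) (S : Trunc d α β γ) (ω : Ω × (S.1.H → Ω))
    (i : S.1.N → Fin d) :
    f S ω i = f S (ω.1, fun p => spread S.1.H ω (rep p.1)) (fun x => i ⟨x.1, x.2⟩) := by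
  have e : (fun p : S.1.H => spread S.1.H ω (rep p.1)) = ω.2 := funext fun p =>
    spread_eq S.1.H_partition ω p.2 (rep_mem (S.1.nonempty_of_mem_H p.2))
  rw [e]

lemma val_self (f : Family ℙ d α β γ) (T : Trunc d α β γ) (ω : Ω × (T.1.H → Ω))
    (i : T.1.N → Fin d) : val f T T.1.N ω i = f T ω i := by
  rw [eval_eq f T ω i]
  exact eval_congr f (Subtype.ext T.1.sub_self) (T.1.sub_N_subset _) subset_rfl ω.1 _ _
    (fun _ _ => rfl) i

lemma coeff_ext {N : Finset ℕ} {H : Finset (Finset ℕ)} {X Y : Coeff ℙ d N H}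
    (h : ∀ᵐ ω ∂prodMeasure ℙ H, ∀ i, X ω i = Y ω i) : X = Y :=
  AEEqFun.ext (h.mono fun _ hω => funext hω)

/-! ### Almost sure identities on induced forests and the formula for the convolution -/

section Transfer

variable [IsProbabilityMeasure ℙ]

/-- The map `restrVar` keeps `ω₀` and selects the variables of distinct blocks, hence preserves the
product measure. -/
lemma ae_restrVar (T : LionsForest d) (A : Finset ℕ) {Q : Ω × ((T.sub A).H → Ω) → Prop}
    (h : ∀ᵐ ω ∂prodMeasure ℙ (T.sub A).H, Q ω) :
    ∀ᵐ ω ∂prodMeasure ℙ T.H, Q (restrVar T A ω) := by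
  obtain ⟨b, hb, hs⟩ := T.exists_block A
  exact ae_reindex T.H_partition none b hb (fun _ => by simp) (fun p => rep p.1)
    (fun p => hs p (rep_mem ((T.sub A).nonempty_of_mem_H p.2))) h

lemma coupledTensor_ae {M₁ M₂ N₁ N₂ K : Finset ℕ} {P Q G : Finset (Finset ℕ)}
    (hG : IsCoupling M₁ M₂ P Q G) (hK : N₁ ∪ N₂ = K) (X : Coeff ℙ d N₁ P)
    (Y : Coeff ℙ d N₂ Q) :
    ∀ᵐ ω ∂prodMeasure ℙ G, ∀ i, coupledTensor hG hK X Y ω i =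
      X (ω.1, fun p => spread G ω (rep p.1))
        (fun x => i ⟨x.1, hK ▸ Finset.mem_union_left N₂ x.2⟩) *
      Y (ω.1, fun p => spread G ω (rep p.1))
        (fun x => i ⟨x.1, hK ▸ Finset.mem_union_right N₁ x.2⟩) := by
  filter_upwards [AEEqFun.coeFn_mk (μ := prodMeasure ℙ G) (fun ω (i : K → Fin d) =>
      X (ω.1, fun p => ω.2 (psi hG.left p))
        (fun x => i ⟨x.1, hK ▸ Finset.mem_union_left N₂ x.2⟩) *
      Y (ω.1, fun p => ω.2 (psi hG.right p))
        (fun x => i ⟨x.1, hK ▸ Finset.mem_union_right N₁ x.2⟩)) _] with ω hω i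
  refine (congrFun hω i).trans ?_
  simp only [spread_psi hG.partition]

lemma coeff_sum_ae {N : Finset ℕ} {H : Finset (Finset ℕ)} {ι : Type*} (s : Finset ι)
    (X : ι → Coeff ℙ d N H) :
    ∀ᵐ ω ∂prodMeasure ℙ H, ∀ i, (∑ q ∈ s, X q : Coeff ℙ d N H) ω i = ∑ q ∈ s, X q ω i := by
  classical
  induction s using Finset.induction_on with
  | empty =>
    exact Filter.Eventually.of_forall fun ω i => by simp
  | insert a s ha ih =>
    rw [Finset.sum_insert ha]
    filter_upwards [ih, AEEqFun.coeFn_add (X a) (∑ q ∈ s, X q)] with ω h1 h2 i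
    rw [Finset.sum_insert ha, ← h1 i]
    exact congrFun h2 i

/-- Both parts of a cut are induced forests of `T`, and their coupled tensor product is a product of
values read off from the variables of `T`; the cuts are then reindexed by their root nodes. -/
lemma conv_ae (f g : Family ℙ d α β γ) (T : Trunc d α β γ) :
    ∀ᵐ ω ∂prodMeasure ℙ T.1.H, ∀ i, conv f g T ω i =
      ∑ R ∈ T.1.ups, val f T (T.1.N \ R) ω i * val g T R ω i := by
  have h1 : ∀ᵐ ω ∂prodMeasure ℙ T.1.H, ∀ q ∈ T.1.cuts, ∀ i,
      coupledTensor (T.1.cut_coupling q) (T.1.cut_nodes q) (f (T.prune q)) (g (T.root q)) ω i =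
      val f T (T.1.N \ T.1.rootNodes q) ω i * val g T (T.1.rootNodes q) ω i := by
    rw [Filter.eventually_all_finset]
    intro q _
    filter_upwards [coupledTensor_ae (T.1.cut_coupling q) (T.1.cut_nodes q) (f (T.prune q))
      (g (T.root q))] with ω hω i
    refine (hω i).trans ?_
    have hR := LionsForest.rootNodes_mem_ups (T := T.1) q
    congr 1
    · exact eval_congr f (Subtype.ext (LionsForest.sub_eq_restrict
        (LionsForest.convex_compl hR)).symm) (K := T.1.N) Finset.sdiff_subset
        (T.1.sub_N_subset _) ω.1 _ _ (fun _ _ => rfl) i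
    · exact eval_congr g (Subtype.ext (LionsForest.sub_eq_restrict
        (LionsForest.convex_of_mem_ups hR)).symm) (K := T.1.N)
        (LionsForest.mem_ups.1 hR).1 (T.1.sub_N_subset _) ω.1 _ _ (fun _ _ => rfl) i
  filter_upwards [h1, coeff_sum_ae T.1.cuts fun q => coupledTensor (T.1.cut_coupling q)
    (T.1.cut_nodes q) (f (T.prune q)) (g (T.root q))] with ω h1 h2 i
  refine (h2 i).trans ?_
  rw [← T.1.sum_cuts fun R => val f T (T.1.N \ R) ω i * val g T R ω i]
  exact Finset.sum_congr rfl fun q hq => h1 q hq i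

/-- A property of the coefficients of all forests holds for all induced forests at once. -/
lemma ae_forall_sub (T : LionsForest d) {Q : ∀ S : LionsForest d, Ω × (S.H → Ω) → Prop}
    (h : ∀ A, T.Convex A → ∀ᵐ ω ∂prodMeasure ℙ (T.sub A).H, Q (T.sub A) ω) :
    ∀ᵐ ω ∂prodMeasure ℙ T.H, ∀ A, T.Convex A → Q (T.sub A) (restrVar T A ω) := by
  refine ae_all_iff.2 fun A => ?_
  by_cases hA : T.Convex A
  · exact (ae_restrVar T A (h A hA)).mono fun _ h _ => h
  · exact Filter.Eventually.of_forall fun _ h => absurd h hA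

/-- The map `R ↦ A ∪ R` identifies the parent-closed sets of the forest induced on `B \ A` with
those of `T` between `A` and `B`. One exceptional null set serves all pairs, so sums can be nested
pointwise. -/
lemma conv_val_ae (f g : Family ℙ d α β γ) (T : Trunc d α β γ) :
    ∀ᵐ ω ∂prodMeasure ℙ T.1.H, ∀ A B, A ∈ T.1.ups → B ∈ T.1.ups → A ⊆ B → ∀ i,
      val (conv f g) T (B \ A) ω i =
      ∑ R ∈ T.1.ups with A ⊆ R ∧ R ⊆ B, val f T (B \ R) ω i * val g T (R \ A) ω i := by
  -- The predicate concerns bare forests, so the truncation bound is quantified inside it.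
  have := ae_forall_sub (ℙ := ℙ) T.1 (Q := fun S ω => ∀ h : S.grade α β ≤ γ, ∀ i,
      conv f g ⟨S, h⟩ ω i = ∑ R ∈ S.ups, val f ⟨S, h⟩ (S.N \ R) ω i * val g ⟨S, h⟩ R ω i)
    (fun A _ => (conv_ae f g (T.sub A)).mono fun _ h _ => h)
  filter_upwards [this] with ω h A B hA hB hAB i
  have hC := LionsForest.convex_sdiff hA hB
  refine (h (B \ A) hC (T.sub (B \ A)).2 (restrLeg T.1 (B \ A) i)).trans ?_
  rw [LionsForest.sub_N hC]
  refine Finset.sum_bij' (fun R _ => A ∪ R) (fun R _ => R \ A) ?_ ?_ ?_ ?_ ?_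
  · intro R hR
    rw [LionsForest.mem_ups_sub_sdiff hA hB] at hR
    exact Finset.mem_filter.2 ⟨hR.2, Finset.subset_union_left,
      Finset.union_subset hAB (hR.1.trans Finset.sdiff_subset)⟩
  · intro R hR
    obtain ⟨hR, h1, h2⟩ := Finset.mem_filter.1 hR
    rw [LionsForest.mem_ups_sub_sdiff hA hB, Finset.union_sdiff_of_subset h1]
    exact ⟨Finset.sdiff_subset_sdiff h2 subset_rfl, hR⟩
  · intro R hR
    rw [LionsForest.mem_ups_sub_sdiff hA hB] at hR
    exact Finset.union_sdiff_cancel_left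
      (Finset.disjoint_left.2 fun x hx hx' => (Finset.mem_sdiff.1 (hR.1 hx')).2 hx)
  · intro R hR
    exact Finset.union_sdiff_of_subset (Finset.mem_filter.1 hR).2.1
  · intro R hR
    rw [LionsForest.mem_ups_sub_sdiff hA hB] at hR
    have e : (A ∪ R) \ A = R := Finset.union_sdiff_cancel_left
      (Finset.disjoint_left.2 fun x hx hx' => (Finset.mem_sdiff.1 (hR.1 hx')).2 hx)
    have e' : (B \ A) \ R = B \ (A ∪ R) := sdiff_sdiff_left
    rw [e, e']
    have c1 := LionsForest.convex_sdiff hR.2 hB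
    have c2 := e ▸ LionsForest.convex_sdiff hA hR.2
    rw [← val_sub f hC c1 (Finset.sdiff_subset_sdiff subset_rfl Finset.subset_union_left),
      ← val_sub g hC c2 hR.1]
    rfl

end Transfer
end Values

/-! ### The convolution algebra -/

section Algebra

variable {Ω : Type*} [MeasurableSpace Ω] {ℙ : Measure Ω} {d : ℕ} {α β γ : ℝ≥0}

lemma family_ext {f g : Family ℙ d α β γ}
    (h : ∀ T : Trunc d α β γ, ∀ᵐ ω ∂prodMeasure ℙ T.1.H, ∀ i, f T ω i = g T ω i) : f = g :=
  funext fun T => coeff_ext (h T)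

lemma counit_sub_eq_zero {f : Family ℙ d α β γ} (h1 : ∀ T : Trunc d α β γ, T.1.N = ∅ → f T = 1)
    (T : Trunc d α β γ) (hT : T.1.N = ∅) : (counit - f : Family ℙ d α β γ) T = 0 := by
  rw [Pi.sub_apply, h1 T hT, counit, if_pos hT, sub_self]

variable [IsProbabilityMeasure ℙ]

lemma coeff_one_apply {N : Finset ℕ} {H : Finset (Finset ℕ)} (ω : Ω × (H → Ω))
    (i : N → Fin d) : (1 : Coeff ℙ d N H) ω i = 1 := by simp

lemma coeff_zero_apply {N : Finset ℕ} {H : Finset (Finset ℕ)} (ω : Ω × (H → Ω))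
    (i : N → Fin d) : (0 : Coeff ℙ d N H) ω i = 0 := by simp

lemma counit_apply (T : Trunc d α β γ) (ω : Ω × (T.1.H → Ω)) (i : T.1.N → Fin d) :
    (counit : Family ℙ d α β γ) T ω i = if T.1.N = ∅ then 1 else 0 := by
  unfold counit
  split_ifs <;> simp

lemma counit_val {T : Trunc d α β γ} {A : Finset ℕ} (hA : T.1.Convex A) (ω : Ω × (T.1.H → Ω))
    (i : T.1.N → Fin d) :
    val (counit : Family ℙ d α β γ) T A ω i = if A = ∅ then 1 else 0 := by
  refine (counit_apply (T.sub A) _ _).trans (if_congr ?_ rfl rfl)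
  change (T.1.sub A).N = ∅ ↔ A = ∅
  rw [LionsForest.sub_N hA]

lemma val_eq_one {f : Family ℙ d α β γ} (h1 : ∀ T : Trunc d α β γ, T.1.N = ∅ → f T = 1)
    (T : Trunc d α β γ) (ω : Ω × (T.1.H → Ω)) (i : T.1.N → Fin d) : val f T ∅ ω i = 1 := by
  rw [val, h1 (T.sub ∅) (LionsForest.sub_N (LionsForest.convex_of_mem_ups T.1.empty_mem_ups))]
  exact coeff_one_apply _ _

lemma val_eq_zero {f : Family ℙ d α β γ} {T : Trunc d α β γ} {A : Finset ℕ}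
    (h : f (T.sub A) = 0) (ω : Ω × (T.1.H → Ω)) (i : T.1.N → Fin d) : val f T A ω i = 0 := by
  rw [val, h]
  exact coeff_zero_apply _ _

lemma sub_val_ae (f g : Family ℙ d α β γ) (T : Trunc d α β γ) :
    ∀ᵐ ω ∂prodMeasure ℙ T.1.H, ∀ A, T.1.Convex A → ∀ i,
      val (f - g) T A ω i = val f T A ω i - val g T A ω i := by
  have := ae_forall_sub (ℙ := ℙ) T.1 (Q := fun S ω => ∀ h : S.grade α β ≤ γ, ∀ i,
      (f - g) ⟨S, h⟩ ω i = f ⟨S, h⟩ ω i - g ⟨S, h⟩ ω i)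
    (fun A _ => (AEEqFun.coeFn_sub (f (T.sub A)) (g (T.sub A))).mono
      fun ω h _ i => congrFun h i)
  filter_upwards [this] with ω h A hA i
  exact h A hA (T.sub A).2 (restrLeg T.1 A i)

lemma sum_val_ae (f : ℕ → Family ℙ d α β γ) (M : ℕ) (g : Family ℙ d α β γ)
    (T : Trunc d α β γ) (hg : ∀ A, g (T.sub A) = ∑ n ∈ Finset.range M, f n (T.sub A)) :
    ∀ᵐ ω ∂prodMeasure ℙ T.1.H, ∀ A, T.1.Convex A → ∀ i,
      val g T A ω i = ∑ n ∈ Finset.range M, val (f n) T A ω i := by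
  refine ae_all_iff.2 fun A => ?_
  filter_upwards [ae_restrVar T.1 A (coeff_sum_ae (ℙ := ℙ) (Finset.range M)
    fun n => f n (T.sub A))] with ω h _ i
  rw [val, hg A]
  exact h (restrLeg T.1 A i)

/-- Both sides are the sum over chains `R ⊆ R'` of `f` on `N \ R'`, `g` on `R' \ R` and `h` on `R`.
-/
lemma conv_assoc (f g h : Family ℙ d α β γ) : conv (conv f g) h = conv f (conv g h) := by
  refine family_ext fun T => ?_
  filter_upwards [conv_ae (conv f g) h T, conv_ae f (conv g h) T, conv_val_ae f g T,
    conv_val_ae g h T] with ω h1 h2 h3 h4 i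
  rw [h1, h2]
  have e1 : ∀ R ∈ T.1.ups, val (conv f g) T (T.1.N \ R) ω i * val h T R ω i =
      ∑ R' ∈ T.1.ups with R ⊆ R' ∧ R' ⊆ T.1.N,
        val f T (T.1.N \ R') ω i * val g T (R' \ R) ω i * val h T R ω i := fun R hR => by
    rw [h3 R T.1.N hR T.1.univ_mem_ups (LionsForest.mem_ups.1 hR).1, Finset.sum_mul]
  have e2 : ∀ R' ∈ T.1.ups, val f T (T.1.N \ R') ω i * val (conv g h) T R' ω i =
      ∑ R ∈ T.1.ups with ∅ ⊆ R ∧ R ⊆ R',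
        val f T (T.1.N \ R') ω i * val g T (R' \ R) ω i * val h T R ω i := fun R' hR' => by
    have := h4 ∅ R' T.1.empty_mem_ups hR' (Finset.empty_subset _) i
    simp only [Finset.sdiff_empty] at this
    rw [this, Finset.mul_sum]
    exact Finset.sum_congr rfl fun R _ => by ring
  rw [Finset.sum_congr rfl e1, Finset.sum_congr rfl e2]
  refine Finset.sum_comm' fun R R' => ?_
  simp only [Finset.mem_filter, Finset.empty_subset, true_and]
  exact ⟨fun ⟨a, b, c, _⟩ => ⟨⟨a, c⟩, b⟩,
    fun ⟨⟨a, c⟩, b⟩ => ⟨a, b, c, (LionsForest.mem_ups.1 b).1⟩⟩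

lemma counit_conv (f : Family ℙ d α β γ) : conv counit f = f := by
  refine family_ext fun T => ?_
  filter_upwards [conv_ae counit f T] with ω h i
  rw [h, Finset.sum_eq_single_of_mem T.1.N T.1.univ_mem_ups]
  · have := LionsForest.convex_compl T.1.univ_mem_ups
    rw [counit_val this, val_self]
    simp
  · intro R hR hne
    rw [counit_val (LionsForest.convex_compl hR), if_neg, zero_mul]
    rw [Finset.sdiff_eq_empty_iff_subset]
    exact fun h => hne (Finset.Subset.antisymm (LionsForest.mem_ups.1 hR).1 h)

/-- Convolution with the counit from the right, at the level of values. -/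
lemma sum_val_mul_counit (f : Family ℙ d α β γ) (T : Trunc d α β γ) (ω : Ω × (T.1.H → Ω))
    (i : T.1.N → Fin d) :
    ∑ R ∈ T.1.ups, val f T (T.1.N \ R) ω i * val (counit : Family ℙ d α β γ) T R ω i =
      f T ω i := by
  rw [Finset.sum_eq_single_of_mem ∅ T.1.empty_mem_ups]
  · rw [counit_val (LionsForest.convex_of_mem_ups T.1.empty_mem_ups), Finset.sdiff_empty,
      val_self]
    simp
  · intro R hR hne
    rw [counit_val (LionsForest.convex_of_mem_ups hR), if_neg hne, mul_zero]

/-- Since `u` kills the empty forest, only terms with `R` non-empty survive, and the preceding power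
then sees at least one node fewer. -/
lemma convPow_eq_zero {u : Family ℙ d α β γ} (hu : ∀ T : Trunc d α β γ, T.1.N = ∅ → u T = 0) :
    ∀ (n : ℕ) (T : Trunc d α β γ), T.1.N.card < n → convPow u n T = 0 := by
  intro n
  induction n with
  | zero => exact fun T hT => absurd hT (Nat.not_lt_zero _)
  | succ n ih =>
    intro T hT
    refine coeff_ext ?_
    filter_upwards [conv_ae (convPow u n) u T] with ω h i
    refine (h i).trans ?_
    rw [Finset.sum_eq_zero]
    · simp
    · intro R hR
      have hc := LionsForest.convex_of_mem_ups hR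
      rcases R.eq_empty_or_nonempty with rfl | hne
      · rw [val_eq_zero (hu (T.sub ∅) (LionsForest.sub_N hc)), mul_zero]
      · have hc' := LionsForest.convex_compl hR
        rw [val_eq_zero (ih (T.sub (T.1.N \ R)) ?_), zero_mul]
        change (T.1.sub (T.1.N \ R)).N.card < n
        rw [LionsForest.sub_N hc']
        have h1 := Finset.card_sdiff_of_subset hc.1
        have h2 := hne.card_pos
        have h3 := Finset.card_le_card hc.1
        omega

/-- The length `M` is only bounded from below, so that one truncation of the series is valid for a
forest and all its induced forests simultaneously. -/
lemma antipode_eq_sum {f : Family ℙ d α β γ} (h1 : ∀ T : Trunc d α β γ, T.1.N = ∅ → f T = 1)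
    {M : ℕ} (T : Trunc d α β γ) (hM : T.1.N.card < M) :
    antipode f T = ∑ n ∈ Finset.range M, convPow (counit - f) n T := by
  refine finsum_eq_sum_of_support_subset _ fun n hn => ?_
  rw [Finset.coe_range, Set.mem_Iio]
  by_contra hlt
  exact hn (convPow_eq_zero (counit_sub_eq_zero h1) n T (by omega))

/-- A geometric series: with `u = ε - f`, each term satisfies `u^n ∗ f = u^n - u^(n+1)`. The sum
telescopes to `u^0 = ε`, because the last power vanishes on `T`. -/
lemma antipode_conv {f : Family ℙ d α β γ} (h1 : ∀ T : Trunc d α β γ, T.1.N = ∅ → f T = 1) :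
    conv (antipode f) f = counit := by
  refine family_ext fun T => ?_
  set u : Family ℙ d α β γ := counit - f with hu
  set M := T.1.N.card + 1 with hM
  have hsum : ∀ A, antipode f (T.sub A) = ∑ n ∈ Finset.range M, convPow u n (T.sub A) :=
    fun A => antipode_eq_sum h1 (T.sub A)
      (Nat.lt_succ_of_le (Finset.card_le_card (T.1.sub_N_subset A)))
  have hpow : ∀ᵐ ω ∂prodMeasure ℙ T.1.H, ∀ n i, convPow u (n + 1) T ω i =
      ∑ R ∈ T.1.ups, val (convPow u n) T (T.1.N \ R) ω i * val u T R ω i :=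
    ae_all_iff.2 fun n => conv_ae (convPow u n) u T
  filter_upwards [conv_ae (antipode f) f T, sum_val_ae (convPow u) M (antipode f) T hsum,
    sub_val_ae counit f T, hpow] with ω e1 e2 e3 e4 i
  -- Here `f` is written as `ε - u` at the level of values, which replaces bilinearity of the
  -- convolution.
  have e5 : ∀ R ∈ T.1.ups, val (antipode f) T (T.1.N \ R) ω i * val f T R ω i =
      ∑ n ∈ Finset.range M, (val (convPow u n) T (T.1.N \ R) ω i *
        val (counit : Family ℙ d α β γ) T R ω i -
        val (convPow u n) T (T.1.N \ R) ω i * val u T R ω i) := by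
    intro R hR
    rw [e2 _ (LionsForest.convex_compl hR), e3 R (LionsForest.convex_of_mem_ups hR),
      Finset.sum_mul]
    exact Finset.sum_congr rfl fun n _ => by ring
  rw [e1, Finset.sum_congr rfl e5, Finset.sum_comm]
  simp only [Finset.sum_sub_distrib, sum_val_mul_counit, ← e4]
  rw [← Finset.sum_sub_distrib, Finset.sum_range_sub' fun n => convPow u n T ω i,
    convPow_eq_zero (counit_sub_eq_zero h1) M T (Nat.lt_succ_self _)]
  simp [convPow]

end Algebra

/-! ### Multiplicative families -/

section Separation

variable {d : ℕ} {T : LionsForest d} {A B C : Finset ℕ}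

/-- `T` is the product of the forests induced on `A` and on `B`. -/
structure LionsForest.Separates (T : LionsForest d) (A B : Finset ℕ) : Prop where
  disjoint : Disjoint A B
  union : A ∪ B = T.N
  left : A ∈ T.ups
  right : B ∈ T.ups
  blocks : ∀ g ∈ T.H, g ⊆ A ∨ g ⊆ B

lemma LionsForest.Separates.symm (h : T.Separates A B) : T.Separates B A :=
  ⟨h.disjoint.symm, by rw [Finset.union_comm, h.union], h.right, h.left,
    fun g hg => (h.blocks g hg).symm⟩

lemma LionsForest.ext_of_label {T T' : LionsForest d} (hN : T.N = T'.N) (hE : T.E = T'.E)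
    (h₀ : T.h₀ = T'.h₀) (hH : T.H = T'.H)
    (hL : ∀ x (hx : x ∈ T.N) (hx' : x ∈ T'.N), T.L ⟨x, hx⟩ = T'.L ⟨x, hx'⟩) : T = T' := by
  refine LionsForest.ext hN hE h₀ hH ?_
  obtain ⟨N, _, _, _, L⟩ := T
  obtain ⟨N', _, _, _, L'⟩ := T'
  simp only at hN hL
  subst hN
  exact heq_of_eq (funext fun x => hL x.1 x.2 x.2)

lemma LionsForest.sub_L (h : T.Convex A) {x : ℕ} (hx : x ∈ (T.sub A).N) (hx' : x ∈ T.N) :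
    (T.sub A).L ⟨x, hx⟩ = T.L ⟨x, hx'⟩ := by
  have aux : ∀ T' (_ : T' = T.restrict A h.1 h.2) (hx : x ∈ T'.N), T'.L ⟨x, hx⟩ = T.L ⟨x, hx'⟩ := by
    rintro _ rfl _
    rfl
  exact aux _ (sub_eq_restrict h) hx

lemma LionsForest.convex_inter (hA : T.Convex A) (hB : T.Convex B) : T.Convex (A ∩ B) := by
  refine ⟨fun x hx => hA.1 (Finset.mem_inter.1 hx).1, fun x hx z hz y hxy hyz => ?_⟩
  rw [Finset.mem_inter] at hx hz ⊢
  exact ⟨hA.2 x hx.1 z hz.1 y hxy hyz, hB.2 x hx.2 z hz.2 y hxy hyz⟩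

lemma LionsForest.inter_mem_ups_sub (hA : A ∈ T.ups) (hC : T.Convex C) :
    A ∩ C ∈ (T.sub C).ups := by
  rw [mem_ups, sub_N hC, sub_E hC]
  refine ⟨Finset.inter_subset_right, fun x y hxy hx => ?_⟩
  rw [Finset.mem_inter] at hx ⊢
  rw [mem_restrictE] at hxy
  exact ⟨(mem_ups.1 hA).2 x y hxy.1 hx.1, hxy.2.2⟩

lemma LionsForest.Separates.sub (h : T.Separates A B) (hC : T.Convex C) :
    (T.sub C).Separates (A ∩ C) (B ∩ C) := by
  refine ⟨h.disjoint.mono Finset.inter_subset_left Finset.inter_subset_left, ?_,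
    inter_mem_ups_sub h.left hC, inter_mem_ups_sub h.right hC, fun p hp => ?_⟩
  · rw [← Finset.union_inter_distrib_right, h.union, sub_N hC, Finset.inter_eq_right.2 hC.1]
  · rw [sub_H hC, mem_trace] at hp
    obtain ⟨_, g, hg, rfl⟩ := hp
    exact (h.blocks g hg).imp (fun h => Finset.inter_subset_inter h subset_rfl)
      fun h => Finset.inter_subset_inter h subset_rfl

lemma LionsForest.Separates.edges (h : T.Separates A B) :
    restrictE T.E A ∪ restrictE T.E B = T.E := by
  ext ⟨x, y⟩
  rw [Finset.mem_union, mem_restrictE, mem_restrictE]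
  refine ⟨fun h => h.elim And.left And.left, fun hxy => ?_⟩
  have hx := (T.E_subset x y hxy).1
  rw [← h.union, Finset.mem_union] at hx
  exact hx.imp (fun hx => ⟨hxy, hx, (mem_ups.1 h.left).2 x y hxy hx⟩)
    fun hx => ⟨hxy, hx, (mem_ups.1 h.right).2 x y hxy hx⟩

lemma LionsForest.Separates.hyperedges (h : T.Separates A B) :
    trace T.H A ∪ trace T.H B = T.H := by
  have key : ∀ {A B : Finset ℕ}, Disjoint A B → (∀ g ∈ T.H, g ⊆ A ∨ g ⊆ B) → ∀ g ∈ T.H, ∀ x ∈ g,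
      x ∈ A → g ∩ A = g := by
    intro A B hd hb g hg x hx hxA
    rcases hb g hg with h | h
    · exact Finset.inter_eq_left.2 h
    · exact absurd (h hx) (Finset.disjoint_left.1 hd hxA)
  ext p
  rw [Finset.mem_union, mem_trace, mem_trace]
  constructor
  · rintro (⟨⟨x, hx⟩, g, hg, rfl⟩ | ⟨⟨x, hx⟩, g, hg, rfl⟩)
    · rw [Finset.mem_inter] at hx
      rwa [key h.disjoint h.blocks g hg x hx.1 hx.2]
    · rw [Finset.mem_inter] at hx
      rwa [key h.symm.disjoint h.symm.blocks g hg x hx.1 hx.2]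
  · intro hp
    have hne := T.nonempty_of_mem_H hp
    exact (h.blocks p hp).imp (fun h => ⟨hne, p, hp, Finset.inter_eq_left.2 h⟩)
      fun h => ⟨hne, p, hp, Finset.inter_eq_left.2 h⟩

/-- Since no edge and no hyperedge crosses between `A` and `B`, and `⊛` merges the two traces of
`h₀`, nothing is lost by restricting to the two sides. Multiplicativity can thus be tested on
splittings of one forest. -/
lemma LionsForest.Separates.eq_mul (h : T.Separates A B)
    (hd : Disjoint (T.sub A).N (T.sub B).N) : T = (T.sub A).mul (T.sub B) hd := by
  have hA := convex_of_mem_ups h.left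
  have hB := convex_of_mem_ups h.right
  refine ext_of_label ?_ ?_ ?_ ?_ fun x hx hx' => ?_
  · change T.N = (T.sub A).N ∪ (T.sub B).N
    rw [sub_N hA, sub_N hB, h.union]
  · change T.E = (T.sub A).E ∪ (T.sub B).E
    rw [sub_E hA, sub_E hB, h.edges]
  · change T.h₀ = (T.sub A).h₀ ∪ (T.sub B).h₀
    rw [sub_h₀ hA, sub_h₀ hB, ← Finset.inter_union_distrib_left, h.union,
      Finset.inter_eq_left.2 T.h₀_subset]
  · change T.H = (T.sub A).H ∪ (T.sub B).H
    rw [sub_H hA, sub_H hB, h.hyperedges]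
  · simp only [mul]
    split_ifs with hxA
    · exact (sub_L hA _ _).symm
    · exact (sub_L hB _ _).symm

lemma LionsForest.separates_mul (T₁ T₂ : LionsForest d) (hd : Disjoint T₁.N T₂.N) :
    (T₁.mul T₂ hd).Separates T₁.N T₂.N := by
  refine ⟨hd, rfl, mem_ups.2 ⟨Finset.subset_union_left, fun x y hxy hx => ?_⟩,
    mem_ups.2 ⟨Finset.subset_union_right, fun x y hxy hx => ?_⟩, fun g hg => ?_⟩
  · rcases Finset.mem_union.1 hxy with h | h
    · exact (T₁.E_subset x y h).2
    · exact absurd (T₂.E_subset x y h).1 (Finset.disjoint_left.1 hd hx)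
  · rcases Finset.mem_union.1 hxy with h | h
    · exact absurd hx (Finset.disjoint_left.1 hd (T₁.E_subset x y h).1)
    · exact (T₂.E_subset x y h).2
  · exact (Finset.mem_union.1 hg).imp
      (fun h => (T₁.subset_of_mem_H h).trans Finset.sdiff_subset)
      fun h => (T₂.subset_of_mem_H h).trans Finset.sdiff_subset

lemma restrictE_union {N₁ N₂ : Finset ℕ} {E₁ E₂ : Finset (ℕ × ℕ)} (hd : Disjoint N₁ N₂)
    (h₁ : ∀ x y, (x, y) ∈ E₁ → x ∈ N₁ ∧ y ∈ N₁) (h₂ : ∀ x y, (x, y) ∈ E₂ → x ∈ N₂ ∧ y ∈ N₂) :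
    restrictE (E₁ ∪ E₂) N₁ = E₁ := by
  ext ⟨x, y⟩
  rw [mem_restrictE, Finset.mem_union]
  constructor
  · rintro ⟨h | h, hx, _⟩
    · exact h
    · exact absurd (h₂ x y h).1 (Finset.disjoint_left.1 hd hx)
  · exact fun h => ⟨Or.inl h, h₁ x y h⟩

lemma LionsForest.sub_mul_left (T₁ T₂ : LionsForest d) (hd : Disjoint T₁.N T₂.N) :
    (T₁.mul T₂ hd).sub T₁.N = T₁ := by
  have hA := convex_of_mem_ups (separates_mul T₁ T₂ hd).left
  refine ext_of_label (sub_N hA) ?_ ?_ ?_ fun x hx hx' => ?_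
  · rw [sub_E hA]
    exact restrictE_union hd T₁.E_subset T₂.E_subset
  · rw [sub_h₀ hA]
    change (T₁.h₀ ∪ T₂.h₀) ∩ T₁.N = T₁.h₀
    rw [Finset.union_inter_distrib_right, Finset.inter_eq_left.2 T₁.h₀_subset,
      Finset.disjoint_iff_inter_eq_empty.1 (hd.symm.mono_left T₂.h₀_subset), Finset.union_empty]
  · rw [sub_H hA]
    exact trace_eq_self T₁.H_partition Finset.sdiff_subset fun g hg =>
      hd.symm.mono_left ((T₂.subset_of_mem_H hg).trans Finset.sdiff_subset)
  · rw [sub_L hA hx (Finset.mem_union_left _ hx')]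
    exact dif_pos hx'

lemma LionsForest.sub_mul_right (T₁ T₂ : LionsForest d) (hd : Disjoint T₁.N T₂.N) :
    (T₁.mul T₂ hd).sub T₂.N = T₂ := by
  have hA := convex_of_mem_ups (separates_mul T₁ T₂ hd).right
  refine ext_of_label (sub_N hA) ?_ ?_ ?_ fun x hx hx' => ?_
  · rw [sub_E hA]
    change restrictE (T₁.E ∪ T₂.E) T₂.N = T₂.E
    rw [Finset.union_comm]
    exact restrictE_union hd.symm T₂.E_subset T₁.E_subset
  · rw [sub_h₀ hA]
    change (T₁.h₀ ∪ T₂.h₀) ∩ T₂.N = T₂.h₀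
    rw [Finset.union_inter_distrib_right, Finset.inter_eq_left.2 T₂.h₀_subset,
      Finset.disjoint_iff_inter_eq_empty.1 (hd.mono_left T₁.h₀_subset), Finset.empty_union]
  · rw [sub_H hA]
    change trace (T₁.H ∪ T₂.H) T₂.N = T₂.H
    rw [Finset.union_comm]
    exact trace_eq_self T₂.H_partition Finset.sdiff_subset fun g hg =>
      hd.mono_left ((T₁.subset_of_mem_H hg).trans Finset.sdiff_subset)
  · rw [sub_L hA hx (Finset.mem_union_right _ hx')]
    exact dif_neg (Finset.disjoint_right.1 hd hx')

lemma LionsForest.Separates.inter_compl (h : T.Separates A B) : A ∩ (T.N \ C) = A \ C := by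
  rw [← Finset.inter_sdiff_assoc, Finset.inter_eq_left.2 (mem_ups.1 h.left).1]

/-- A parent-closed set is determined by its traces on the two sides, and any two parent-closed sets
inside `A` and `B` can be united. Summands that are products therefore give a product of sums. -/
lemma LionsForest.Separates.sum_ups {M : Type*} [AddCommMonoid M] (h : T.Separates A B)
    (F : Finset ℕ → Finset ℕ → M) :
    ∑ R ∈ T.ups, F (A ∩ R) (B ∩ R) =
      ∑ R₁ ∈ T.ups with R₁ ⊆ A, ∑ R₂ ∈ T.ups with R₂ ⊆ B, F R₁ R₂ := by
  rw [← Finset.sum_product']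
  have eA : ∀ {R₁ R₂ : Finset ℕ}, R₁ ⊆ A → R₂ ⊆ B → A ∩ (R₁ ∪ R₂) = R₁ := fun h1 h2 => by
    rw [Finset.inter_union_distrib_left, Finset.inter_eq_right.2 h1,
      Finset.disjoint_iff_inter_eq_empty.1 (h.disjoint.mono_right h2), Finset.union_empty]
  have eB : ∀ {R₁ R₂ : Finset ℕ}, R₁ ⊆ A → R₂ ⊆ B → B ∩ (R₁ ∪ R₂) = R₂ := fun h1 h2 => by
    rw [Finset.inter_union_distrib_left, Finset.inter_eq_right.2 h2,
      Finset.disjoint_iff_inter_eq_empty.1 (h.disjoint.symm.mono_right h1), Finset.empty_union]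
  refine Finset.sum_bij' (fun R _ => (A ∩ R, B ∩ R)) (fun R _ => R.1 ∪ R.2) ?_ ?_ ?_ ?_
    (fun _ _ => rfl)
  · intro R hR
    simp only [Finset.mem_product, Finset.mem_filter]
    exact ⟨⟨inter_mem_ups h.left hR, Finset.inter_subset_left⟩,
      inter_mem_ups h.right hR, Finset.inter_subset_left⟩
  · intro R hR
    simp only [Finset.mem_product, Finset.mem_filter] at hR
    exact union_mem_ups hR.1.1 hR.2.1
  · intro R hR
    rw [← Finset.union_inter_distrib_right, h.union]
    exact Finset.inter_eq_right.2 (mem_ups.1 hR).1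
  · intro R hR
    simp only [Finset.mem_product, Finset.mem_filter] at hR
    exact Prod.ext (eA hR.1.2 hR.2.2) (eB hR.1.2 hR.2.2)

end Separation

/-! ### Multiplicativity of convolutions and of left inverses -/

section Multiplicative

variable {Ω : Type*} [MeasurableSpace Ω] {ℙ : Measure Ω} {d : ℕ} {α β γ : ℝ≥0}

/-- The multiplicativity of a character, in terms of induced forests. -/
def IsMultiplicative (f : Family ℙ d α β γ) : Prop :=
  ∀ (T : Trunc d α β γ) (A B : Finset ℕ), T.1.Separates A B →
    ∀ᵐ ω ∂prodMeasure ℙ T.1.H, ∀ i, f T ω i = val f T A ω i * val f T B ω i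

variable [IsProbabilityMeasure ℙ]

/-- The two factors are the forests induced on `T₁.N` and `T₂.N`, so their coupled tensor product is
a product of values on the single forest `T₁ ⊛ T₂`. -/
lemma mul_iff (f : Family ℙ d α β γ) (T₁ T₂ : Trunc d α β γ) (hd : Disjoint T₁.1.N T₂.1.N)
    (h : (T₁.1.mul T₂.1 hd).grade α β ≤ γ) :
    f ⟨T₁.1.mul T₂.1 hd, h⟩ = coupledTensor (T₁.1.mul_coupling T₂.1 hd) rfl (f T₁) (f T₂) ↔
      ∀ᵐ ω ∂prodMeasure ℙ (T₁.1.mul T₂.1 hd).H, ∀ i, f ⟨T₁.1.mul T₂.1 hd, h⟩ ω i =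
        val f ⟨T₁.1.mul T₂.1 hd, h⟩ T₁.1.N ω i * val f ⟨T₁.1.mul T₂.1 hd, h⟩ T₂.1.N ω i := by
  have key : ∀ᵐ ω ∂prodMeasure ℙ (T₁.1.mul T₂.1 hd).H, ∀ i,
      coupledTensor (T₁.1.mul_coupling T₂.1 hd) rfl (f T₁) (f T₂) ω i =
        val f ⟨T₁.1.mul T₂.1 hd, h⟩ T₁.1.N ω i * val f ⟨T₁.1.mul T₂.1 hd, h⟩ T₂.1.N ω i := by
    filter_upwards [coupledTensor_ae (T₁.1.mul_coupling T₂.1 hd) rfl (f T₁) (f T₂)] with ω hω i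
    refine (hω i).trans ?_
    congr 1
    · exact eval_congr f (Subtype.ext (LionsForest.sub_mul_left T₁.1 T₂.1 hd).symm)
        (K := T₁.1.N ∪ T₂.1.N) Finset.subset_union_left
        ((T₁.1.mul T₂.1 hd).sub_N_subset _) ω.1 _ _ (fun _ _ => rfl) i
    · exact eval_congr f (Subtype.ext (LionsForest.sub_mul_right T₁.1 T₂.1 hd).symm)
        (K := T₁.1.N ∪ T₂.1.N) Finset.subset_union_right
        ((T₁.1.mul T₂.1 hd).sub_N_subset _) ω.1 _ _ (fun _ _ => rfl) i
  constructor
  · intro e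
    rw [e]
    exact key
  · intro e
    refine coeff_ext ?_
    filter_upwards [e, key] with ω h1 h2 i
    exact (h1 i).trans (h2 i).symm

lemma IsMultiplicative.mul {f : Family ℙ d α β γ} (hf : IsMultiplicative f)
    (T₁ T₂ : Trunc d α β γ) (hd : Disjoint T₁.1.N T₂.1.N)
    (h : (T₁.1.mul T₂.1 hd).grade α β ≤ γ) :
    f ⟨T₁.1.mul T₂.1 hd, h⟩ = coupledTensor (T₁.1.mul_coupling T₂.1 hd) rfl (f T₁) (f T₂) :=
  (mul_iff f T₁ T₂ hd h).2 (hf _ _ _ (LionsForest.separates_mul T₁.1 T₂.1 hd))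

lemma IsCharacter.isMultiplicative {f : Family ℙ d α β γ} (hf : IsCharacter f) :
    IsMultiplicative f := by
  -- The equality with a product is taken as a hypothesis on a variable forest, so that it can be
  -- eliminated despite the dependent types.
  have aux : ∀ (S T₁ T₂ : Trunc d α β γ) (hd : Disjoint T₁.1.N T₂.1.N),
      S.1 = T₁.1.mul T₂.1 hd → ∀ᵐ ω ∂prodMeasure ℙ S.1.H, ∀ i,
        f S ω i = val f S T₁.1.N ω i * val f S T₂.1.N ω i := by
    rintro ⟨_, hS⟩ T₁ T₂ hd rfl
    exact (mul_iff f T₁ T₂ hd hS).1 (hf.mul T₁ T₂ hd hS)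
  intro T A B h
  have eA := LionsForest.sub_N (LionsForest.convex_of_mem_ups h.left)
  have eB := LionsForest.sub_N (LionsForest.convex_of_mem_ups h.right)
  have hd : Disjoint (T.1.sub A).N (T.1.sub B).N := by
    rw [eA, eB]
    exact h.disjoint
  have := aux T (T.sub A) (T.sub B) hd (h.eq_mul hd)
  change ∀ᵐ ω ∂prodMeasure ℙ T.1.H, ∀ i,
    f T ω i = val f T (T.1.sub A).N ω i * val f T (T.1.sub B).N ω i at this
  rwa [eA, eB] at this

/-- Splittings restrict to induced forests. The size predicate `p` allows two uses: with no
restriction for a family known to be multiplicative, and with sizes below `n` for an induction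
hypothesis. -/
lemma IsMultiplicative.val_ae {f : Family ℙ d α β γ} {T : Trunc d α β γ} {A B : Finset ℕ}
    (hT : T.1.Separates A B) {p : ℕ → Prop}
    (hf : ∀ S : Trunc d α β γ, p S.1.N.card → ∀ A B, S.1.Separates A B →
      ∀ᵐ ω ∂prodMeasure ℙ S.1.H, ∀ i, f S ω i = val f S A ω i * val f S B ω i) :
    ∀ᵐ ω ∂prodMeasure ℙ T.1.H, ∀ C, T.1.Convex C → p C.card → ∀ i,
      val f T C ω i = val f T (A ∩ C) ω i * val f T (B ∩ C) ω i := by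
  refine ae_all_iff.2 fun C => ?_
  by_cases hC : T.1.Convex C ∧ p C.card
  · have hcard : p (T.1.sub C).N.card := by
      rw [LionsForest.sub_N hC.1]
      exact hC.2
    filter_upwards [ae_restrVar T.1 C (hf (T.sub C) hcard _ _ (hT.sub hC.1))] with ω h _ _ i
    refine (h (restrLeg T.1 C i)).trans (congrArg₂ (· * ·) ?_ ?_)
    · exact val_sub f hC.1 (LionsForest.convex_inter
        (LionsForest.convex_of_mem_ups hT.left) hC.1) Finset.inter_subset_right ω i
    · exact val_sub f hC.1 (LionsForest.convex_inter
        (LionsForest.convex_of_mem_ups hT.right) hC.1) Finset.inter_subset_right ω i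
  · exact Filter.Eventually.of_forall fun _ h hp => absurd ⟨h, hp⟩ hC

/-- Each `R` splits into its traces on `A` and `B`, all four factors separate accordingly, and the
sum factorises by `Separates.sum_ups`. -/
lemma IsMultiplicative.conv {f g : Family ℙ d α β γ} (hf : IsMultiplicative f)
    (hg : IsMultiplicative g) : IsMultiplicative (conv f g) := by
  intro T A B hT
  filter_upwards [conv_ae f g T, conv_val_ae f g T,
    val_ae hT (p := fun _ => True) fun S _ => hf S,
    val_ae hT (p := fun _ => True) fun S _ => hg S] with ω h1 h2 h3 h4 i
  have e : ∀ C ∈ T.1.ups, val (Lions.conv f g) T C ω i =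
      ∑ R ∈ T.1.ups with R ⊆ C, val f T (C \ R) ω i * val g T R ω i := fun C hC => by
    have := h2 ∅ C T.1.empty_mem_ups hC (Finset.empty_subset _) i
    simpa only [Finset.sdiff_empty, Finset.empty_subset, true_and] using this
  rw [h1, e A hT.left, e B hT.right, Finset.sum_mul_sum, ← hT.sum_ups fun R₁ R₂ =>
    (val f T (A \ R₁) ω i * val g T R₁ ω i) * (val f T (B \ R₂) ω i * val g T R₂ ω i)]
  refine Finset.sum_congr rfl fun R hR => ?_
  rw [h3 _ (LionsForest.convex_compl hR) trivial, h4 _ (LionsForest.convex_of_mem_ups hR) trivial,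
    hT.inter_compl, hT.symm.inter_compl, Finset.sdiff_inter_self_left,
    Finset.sdiff_inter_self_left]
  ring

lemma IsMultiplicative.counit : IsMultiplicative (counit : Family ℙ d α β γ) := by
  intro T A B hT
  refine Filter.Eventually.of_forall fun ω i => ?_
  rw [counit_apply, counit_val (LionsForest.convex_of_mem_ups hT.left),
    counit_val (LionsForest.convex_of_mem_ups hT.right), ite_zero_mul_ite_zero, mul_one]
  exact if_congr (by rw [← hT.union, Finset.union_eq_empty]) rfl rfl

/-- A left inverse of a multiplicative family is multiplicative. -/
lemma IsMultiplicative.of_conv_eq_counit {f g : Family ℙ d α β γ} (hf : IsMultiplicative f)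
    (h1 : ∀ T : Trunc d α β γ, T.1.N = ∅ → f T = 1) (hgf : Lions.conv g f = Lions.counit) :
    IsMultiplicative g := by
  suffices H : ∀ (n : ℕ) (T : Trunc d α β γ), T.1.N.card = n → ∀ A B, T.1.Separates A B →
      ∀ᵐ ω ∂prodMeasure ℙ T.1.H, ∀ i, g T ω i = val g T A ω i * val g T B ω i from
    fun T => H _ T rfl
  intro n
  induction n using Nat.strong_induction_on with
  | _ n ih =>
  intro T hn A B hT
  filter_upwards [conv_ae g f T, conv_val_ae g f T,
    val_ae hT (p := fun _ => True) fun S _ => hf S,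
    val_ae hT (p := fun m => m < n) fun S hS => ih _ hS S rfl] with ω e1 e2 e3 e4 i
  have hA := LionsForest.convex_of_mem_ups hT.left
  have hB := LionsForest.convex_of_mem_ups hT.right
  have e : ∀ C ∈ T.1.ups, ∑ R ∈ T.1.ups with R ⊆ C, val g T (C \ R) ω i * val f T R ω i =
      if C = ∅ then 1 else 0 := fun C hC => by
    have := e2 ∅ C T.1.empty_mem_ups hC (Finset.empty_subset _) i
    simp only [Finset.sdiff_empty, Finset.empty_subset, true_and] at this
    rw [← this, hgf, counit_val (LionsForest.convex_of_mem_ups hC)]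
  -- The product of the expansions of `ε` on `A` and on `B`, rewritten as a sum over the
  -- parent-closed sets of `T`; it equals the expansion of `ε` on `T`.
  have h3 := hT.sum_ups fun R₁ R₂ =>
    (val g T (A \ R₁) ω i * val f T R₁ ω i) * (val g T (B \ R₂) ω i * val f T R₂ ω i)
  rw [← Finset.sum_mul_sum, e A hT.left, e B hT.right, ite_zero_mul_ite_zero, mul_one] at h3
  have h4 := e1 i
  -- In the difference of the two expansions, the terms with `R ≠ ∅` cancel by the induction
  -- hypothesis. The term `R = ∅` remains, where `f` contributes `1`, and it is the claim.
  rw [hgf, counit_apply, if_congr (by rw [← hT.union, Finset.union_eq_empty]) rfl rfl, ← h3,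
    ← sub_eq_zero, ← Finset.sum_sub_distrib,
    Finset.sum_eq_single_of_mem ∅ T.1.empty_mem_ups] at h4
  · simp only [Finset.inter_empty, Finset.sdiff_empty, val_self, val_eq_one h1, mul_one] at h4
    exact (sub_eq_zero.1 h4).symm
  · intro R hR hne
    have hR' := LionsForest.convex_of_mem_ups hR
    have hlt : (T.1.N \ R).card < n := by
      have c1 := Finset.card_sdiff_of_subset hR'.1
      have c2 := (Finset.nonempty_iff_ne_empty.2 hne).card_pos
      have c3 := Finset.card_le_card hR'.1
      omega
    rw [e4 _ (LionsForest.convex_compl hR) hlt, e3 _ hR' trivial, hT.inter_compl,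
      hT.symm.inter_compl, Finset.sdiff_inter_self_left, Finset.sdiff_inter_self_left]
    ring

end Multiplicative

/-! ### Comparing the coefficients of two forests -/

section Relabel

variable {d : ℕ} {T T' : LionsForest d} {σ : Equiv.Perm ℕ} {A : Finset ℕ}

lemma mem_image_edge {E : Finset (ℕ × ℕ)} {x y : ℕ} :
    (σ x, σ y) ∈ E.image (Prod.map σ σ) ↔ (x, y) ∈ E := by
  simp [Finset.mem_image, Prod.ext_iff]

lemma LionsForest.mem_ups_image (hN : T'.N = T.N.image σ) (hE : T'.E = T.E.image (Prod.map σ σ)) :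
    A.image σ ∈ T'.ups ↔ A ∈ T.ups := by
  rw [mem_ups, mem_ups, hN, hE, Finset.image_subset_image_iff σ.injective]
  refine and_congr_right fun _ => ⟨fun h x y hxy hx => ?_, fun h x y hxy hx => ?_⟩
  · have := h (σ x) (σ y) (mem_image_edge.2 hxy) (Finset.mem_image_of_mem σ hx)
    exact (σ.injective.mem_finset_image).1 this
  · obtain ⟨x, rfl⟩ := σ.surjective x
    obtain ⟨y, rfl⟩ := σ.surjective y
    rw [σ.injective.mem_finset_image] at hx ⊢
    exact h x y (mem_image_edge.1 hxy) hx

lemma LionsForest.sum_ups_image (hN : T'.N = T.N.image σ)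
    (hE : T'.E = T.E.image (Prod.map σ σ)) {M : Type*} [AddCommMonoid M] (F : Finset ℕ → M) :
    ∑ R ∈ T'.ups, F R = ∑ R ∈ T.ups, F (R.image σ) := by
  symm
  refine Finset.sum_bij (fun R _ => R.image σ) (fun R hR => (mem_ups_image hN hE).2 hR)
    (fun _ _ _ _ h => Finset.image_injective σ.injective h) (fun R' hR' => ?_) fun _ _ => rfl
  have e : (R'.image σ.symm).image σ = R' := by simp [Finset.image_image]
  exact ⟨R'.image σ.symm, (mem_ups_image hN hE).1 (by rwa [e]), e⟩

lemma below_image {E : Finset (ℕ × ℕ)} {x y : ℕ}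
    (h : Below (E.image (Prod.map σ σ)) x y) : Below E (σ.symm x) (σ.symm y) := by
  induction h with
  | refl => exact Relation.ReflTransGen.refl
  | @tail b c _ hbc ih =>
    obtain ⟨⟨b, c⟩, he, rfl, rfl⟩ : ∃ e ∈ E, σ e.1 = b ∧ σ e.2 = c := by
      simpa [Edge, Prod.ext_iff] using hbc
    rw [Equiv.symm_apply_apply] at ih ⊢
    exact Relation.ReflTransGen.tail ih he

lemma IsRelabelling.convex_image (h : IsRelabelling σ T T') (hA : T.Convex A) :
    T'.Convex (A.image σ) := by
  refine ⟨by rw [h.nodes]; exact Finset.image_subset_image hA.1, ?_⟩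
  intro x hx z hz y hxy hyz
  rw [h.edges] at hxy hyz
  obtain ⟨x, hxA, rfl⟩ := Finset.mem_image.1 hx
  obtain ⟨z, hzA, rfl⟩ := Finset.mem_image.1 hz
  have h1 := below_image hxy
  have h2 := below_image hyz
  rw [Equiv.symm_apply_apply] at h1 h2
  exact Finset.mem_image.2 ⟨σ.symm y, hA.2 x hxA z hzA _ h1 h2, σ.apply_symm_apply y⟩

lemma IsRelabelling.sub (h : IsRelabelling σ T T') (hA : T.Convex A) :
    IsRelabelling σ (T.sub A) (T'.sub (A.image σ)) := by
  have hA' := h.convex_image hA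
  constructor
  · rw [LionsForest.sub_N hA, LionsForest.sub_N hA']
  · rw [LionsForest.sub_E hA, LionsForest.sub_E hA', h.edges]
    ext ⟨x, y⟩
    obtain ⟨x, rfl⟩ := σ.surjective x
    obtain ⟨y, rfl⟩ := σ.surjective y
    simp only [mem_restrictE, mem_image_edge, σ.injective.mem_finset_image]
  · rw [LionsForest.sub_h₀ hA, LionsForest.sub_h₀ hA', h.zero,
      Finset.image_inter _ _ σ.injective]
  · rw [LionsForest.sub_H hA, LionsForest.sub_H hA', h.hyperedges]
    ext p
    simp only [mem_trace, Finset.mem_image]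
    constructor
    · rintro ⟨hp, _, ⟨g, hg, rfl⟩, rfl⟩
      rw [← Finset.image_inter _ _ σ.injective] at hp ⊢
      exact ⟨g ∩ A, ⟨Finset.image_nonempty.1 hp, g, hg, rfl⟩, rfl⟩
    · rintro ⟨_, ⟨hp, g, hg, rfl⟩, rfl⟩
      exact ⟨hp.image σ, _, ⟨g, hg, rfl⟩, (Finset.image_inter _ _ σ.injective).symm⟩
  · intro x hx hx'
    have hxN := T.sub_N_subset A hx
    have hxN' := T'.sub_N_subset _ hx'
    rw [LionsForest.sub_L hA hx hxN, LionsForest.sub_L hA' hx' hxN', h.labels x hxN hxN']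

/-- The tensor legs of a relabelled forest. -/
def relabelLeg (h : T'.N = T.N.image σ) (i : T'.N → Fin d) : T.N → Fin d :=
  fun x => i ⟨σ x.1, by
    rw [h]
    exact Finset.mem_image_of_mem _ x.2⟩

end Relabel

/-! ### Transfer of coefficients between forests with the same nodes and edges -/

section Comparison

variable {Ω : Type*} [MeasurableSpace Ω] (ℙ : Measure Ω) {d : ℕ}

/-- The nodes of `T'` are those of `T`, renamed by `σ`, and `ρ` yields the variables of `T` in terms
of those of `T'`. -/
structure IsComparison (σ : Equiv.Perm ℕ) (T T' : LionsForest d)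
    (ρ : Ω × (T'.H → Ω) → Ω × (T.H → Ω)) : Prop where
  nodes : T'.N = T.N.image σ
  edges : T'.E = T.E.image (Prod.map σ σ)
  tendsto : Filter.Tendsto ρ (ae (prodMeasure ℙ T'.H)) (ae (prodMeasure ℙ T.H))

variable {ℙ} {α β γ : ℝ≥0} {T T' : Trunc d α β γ} {σ : Equiv.Perm ℕ}
  {ρ : Ω × (T'.1.H → Ω) → Ω × (T.1.H → Ω)}

/-- The coefficients of `f` for `T` and `T'` agree. -/
def IsComparison.Agrees (h : IsComparison ℙ σ T.1 T'.1 ρ) (f : Family ℙ d α β γ) : Prop :=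
  ∀ᵐ ω ∂prodMeasure ℙ T'.1.H, ∀ i, f T' ω i = f T (ρ ω) (relabelLeg h.nodes i)

/-- The coefficients of `f` agree for all induced forests of `T` and `T'`. -/
def IsComparison.AgreesOnSub (h : IsComparison ℙ σ T.1 T'.1 ρ) (f : Family ℙ d α β γ) : Prop :=
  ∀ A, T.1.Convex A → ∀ᵐ ω ∂prodMeasure ℙ T'.1.H, ∀ i,
    val f T' (A.image σ) ω i = val f T A (ρ ω) (relabelLeg h.nodes i)

lemma IsComparison.agrees_sub (h : IsComparison ℙ σ T.1 T'.1 ρ) {f g : Family ℙ d α β γ}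
    (hf : h.Agrees f) (hg : h.Agrees g) : h.Agrees (f - g) := by
  filter_upwards [hf, hg, AEEqFun.coeFn_sub (f T') (g T'),
    h.tendsto.eventually (AEEqFun.coeFn_sub (f T) (g T))] with ω h1 h2 h3 h4 i
  exact (congrFun h3 i).trans ((congrArg₂ (· - ·) (h1 i) (h2 i)).trans (congrFun h4 _).symm)

variable [IsProbabilityMeasure ℙ]

lemma IsComparison.agrees_counit (h : IsComparison ℙ σ T.1 T'.1 ρ) :
    h.Agrees (counit : Family ℙ d α β γ) := by
  refine Filter.Eventually.of_forall fun ω i => ?_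
  rw [counit_apply, counit_apply]
  exact if_congr (by rw [h.nodes, Finset.image_eq_empty]) rfl rfl

lemma IsComparison.agrees_sum (h : IsComparison ℙ σ T.1 T'.1 ρ) (f : ℕ → Family ℙ d α β γ)
    (hf : ∀ n, h.Agrees (f n)) (M : ℕ) (g : Family ℙ d α β γ)
    (hg : g T = ∑ n ∈ Finset.range M, f n T) (hg' : g T' = ∑ n ∈ Finset.range M, f n T') :
    h.Agrees g := by
  filter_upwards [ae_all_iff.2 hf, coeff_sum_ae (Finset.range M) fun n => f n T',
    h.tendsto.eventually (coeff_sum_ae (Finset.range M) fun n => f n T)] with ω h1 h2 h3 i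
  rw [hg, hg']
  refine (h2 i).trans (Eq.trans ?_ (h3 _).symm)
  exact Finset.sum_congr rfl fun n _ => h1 n i

/-- The index set of the convolution depends on nodes and edges alone, so `σ` matches the two sums
term by term even when the hyperedges differ. This lets one argument serve both relabellings and
`𝓔`. -/
lemma IsComparison.agrees_conv (h : IsComparison ℙ σ T.1 T'.1 ρ) {f g : Family ℙ d α β γ}
    (hf : h.AgreesOnSub f) (hg : h.AgreesOnSub g) : h.Agrees (conv f g) := by
  have aux : ∀ {f : Family ℙ d α β γ}, h.AgreesOnSub f → ∀ᵐ ω ∂prodMeasure ℙ T'.1.H,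
      ∀ A, T.1.Convex A → ∀ i,
        val f T' (A.image σ) ω i = val f T A (ρ ω) (relabelLeg h.nodes i) := fun hf =>
    ae_all_iff.2 fun A => by
      by_cases hA : T.1.Convex A
      · exact (hf A hA).mono fun _ h _ => h
      · exact Filter.Eventually.of_forall fun _ h => absurd h hA
  filter_upwards [aux hf, aux hg, conv_ae f g T', h.tendsto.eventually (conv_ae f g T)]
    with ω h1 h2 h3 h4 i
  rw [h3, h4, LionsForest.sum_ups_image h.nodes h.edges]
  refine Finset.sum_congr rfl fun R hR => ?_
  rw [← h1 _ (LionsForest.convex_compl hR), ← h2 _ (LionsForest.convex_of_mem_ups hR), h.nodes,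
    Finset.image_sdiff _ _ σ.injective]

lemma IsComparison.agrees_antipode (h : IsComparison ℙ σ T.1 T'.1 ρ) {f : Family ℙ d α β γ}
    (h1 : ∀ T : Trunc d α β γ, T.1.N = ∅ → f T = 1)
    (hf : ∀ n, h.Agrees (convPow (counit - f) n)) : h.Agrees (antipode f) := by
  refine h.agrees_sum _ hf (T.1.N.card + 1) _ (antipode_eq_sum h1 T (Nat.lt_succ_self _))
    (antipode_eq_sum h1 T' ?_)
  rw [h.nodes]
  exact Nat.lt_succ_of_le Finset.card_image_le

end Comparison

/-! ### Invariance under relabelling -/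

section Invariance

variable {Ω : Type*} {d : ℕ}

/-- The variables of a relabelled forest. -/
def relabelVar {T T' : LionsForest d} {σ : Equiv.Perm ℕ} (h : IsRelabelling σ T T')
    (ω : Ω × (T'.H → Ω)) : Ω × (T.H → Ω) :=
  (ω.1, fun p => ω.2 ⟨p.1.image σ, by
    rw [h.hyperedges]
    exact Finset.mem_image_of_mem _ p.2⟩)

/-- The representative of an image need not be the image of the representative, but both lie in
corresponding blocks. -/
lemma spread_image {T T' : LionsForest d} {σ : Equiv.Perm ℕ} (h : IsRelabelling σ T T')
    (ω : Ω × (T'.H → Ω)) {A : Finset ℕ} {p : Finset ℕ} (hp : p ∈ (T.sub A).H) :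
    spread T'.H ω (rep (p.image σ)) = spread T.H (relabelVar h ω) (rep p) := by
  obtain ⟨b, _, hb⟩ := T.exists_block A
  have hs := hb ⟨p, hp⟩
  have hne := (T.sub A).nonempty_of_mem_H hp
  have hmem : (b ⟨p, hp⟩).1.image σ ∈ T'.H := by
    rw [h.hyperedges]
    exact Finset.mem_image_of_mem _ (b ⟨p, hp⟩).2
  rw [spread_eq T.H_partition _ (b ⟨p, hp⟩).2 (hs (rep_mem hne)),
    spread_eq T'.H_partition ω hmem (Finset.image_subset_image hs (rep_mem (hne.image σ)))]
  rfl

variable [MeasurableSpace Ω] {ℙ : Measure Ω} {α β γ : ℝ≥0} [IsProbabilityMeasure ℙ]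

lemma IsRelabelling.isComparison {T T' : LionsForest d} {σ : Equiv.Perm ℕ}
    (h : IsRelabelling σ T T') : IsComparison ℙ σ T T' (relabelVar h) := by
  refine ⟨h.nodes, h.edges, ?_⟩
  have hφ : Function.Injective fun o : Option T.H => o.map fun p => (⟨p.1.image σ, by
      rw [h.hyperedges]
      exact Finset.mem_image_of_mem _ p.2⟩ : T'.H) :=
    Option.map_injective fun p p' hpp =>
      Subtype.ext (Finset.image_injective σ.injective (congrArg Subtype.val hpp))
  exact (measurePreserving_reindex (ℙ := ℙ) _ hφ).quasiMeasurePreserving.tendsto_ae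

lemma isInvariant_iff {f : Family ℙ d α β γ} : IsInvariant f ↔
    ∀ (σ : Equiv.Perm ℕ) (T T' : Trunc d α β γ) (h : IsRelabelling σ T.1 T'.1),
      (h.isComparison (ℙ := ℙ)).Agrees f := Iff.rfl

/-- A relabelling restricts to one of the induced forests, where invariance of `f` applies and can
be pulled back along `restrVar`. -/
lemma IsInvariant.agreesOnSub {f : Family ℙ d α β γ} (hf : IsInvariant f) {σ : Equiv.Perm ℕ}
    {T T' : Trunc d α β γ} (h : IsRelabelling σ T.1 T'.1) :
    (h.isComparison (ℙ := ℙ)).AgreesOnSub f := by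
  intro A hA
  filter_upwards [ae_restrVar T'.1 (A.image σ)
    (hf σ (T.sub A) (T'.sub (A.image σ)) (h.sub hA))] with ω hω i
  refine (hω (restrLeg T'.1 (A.image σ) i)).trans ?_
  have e : (fun p : (T.1.sub A).H => spread T'.1.H ω (rep (p.1.image σ))) =
      fun p => spread T.1.H (relabelVar h ω) (rep p.1) := funext fun p => spread_image h ω p.2
  exact congrArg (fun v => f (T.sub A) (ω.1, v) (restrLeg T.1 A (relabelLeg h.nodes i))) e

lemma isInvariant_counit : IsInvariant (counit : Family ℙ d α β γ) :=
  isInvariant_iff.2 fun _ _ _ h => (h.isComparison (ℙ := ℙ)).agrees_counit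

lemma IsInvariant.sub {f g : Family ℙ d α β γ} (hf : IsInvariant f) (hg : IsInvariant g) :
    IsInvariant (f - g) :=
  isInvariant_iff.2 fun σ T T' h => (h.isComparison (ℙ := ℙ)).agrees_sub
    (isInvariant_iff.1 hf σ T T' h) (isInvariant_iff.1 hg σ T T' h)

lemma IsInvariant.conv {f g : Family ℙ d α β γ} (hf : IsInvariant f) (hg : IsInvariant g) :
    IsInvariant (conv f g) :=
  isInvariant_iff.2 fun _ _ _ h => (h.isComparison (ℙ := ℙ)).agrees_conv
    (hf.agreesOnSub h) (hg.agreesOnSub h)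

lemma IsInvariant.convPow {f : Family ℙ d α β γ} (hf : IsInvariant f) :
    ∀ n, IsInvariant (convPow f n)
  | 0 => isInvariant_counit
  | n + 1 => (hf.convPow n).conv hf

lemma IsInvariant.antipode {f : Family ℙ d α β γ} (hf : IsInvariant f)
    (h1 : ∀ T : Trunc d α β γ, T.1.N = ∅ → f T = 1) : IsInvariant (antipode f) :=
  isInvariant_iff.2 fun σ T T' h => (h.isComparison (ℙ := ℙ)).agrees_antipode h1 fun n =>
    isInvariant_iff.1 ((isInvariant_counit.sub hf).convPow n) σ T T' h

/-! ### Characters -/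

lemma isCharacter_counit : IsCharacter (counit : Family ℙ d α β γ) :=
  ⟨isInvariant_counit, fun _ hT => if_pos hT, IsMultiplicative.counit.mul⟩

lemma conv_eq_one {f g : Family ℙ d α β γ} (hf : ∀ T : Trunc d α β γ, T.1.N = ∅ → f T = 1)
    (hg : ∀ T : Trunc d α β γ, T.1.N = ∅ → g T = 1) (T : Trunc d α β γ) (hT : T.1.N = ∅) :
    conv f g T = 1 := by
  refine coeff_ext ((conv_ae f g T).mono fun ω h i => ?_)
  have e : T.1.ups = {∅} := by
    ext R
    rw [LionsForest.mem_ups, hT, Finset.subset_empty, Finset.mem_singleton]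
    refine ⟨And.left, ?_⟩
    rintro rfl
    simp
  have hv : val f T (T.1.N \ ∅) ω i = 1 := by
    rw [Finset.sdiff_empty, val_self, hf T hT]
    exact coeff_one_apply _ _
  refine (h i).trans (Eq.trans ?_ (coeff_one_apply _ _).symm)
  rw [e, Finset.sum_singleton, hv, val_eq_one hg, mul_one]

lemma IsCharacter.conv {f g : Family ℙ d α β γ} (hf : IsCharacter f) (hg : IsCharacter g) :
    IsCharacter (conv f g) :=
  ⟨hf.invariant.conv hg.invariant, conv_eq_one hf.one hg.one,
    (hf.isMultiplicative.conv hg.isMultiplicative).mul⟩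

lemma IsCharacter.antipode {f : Family ℙ d α β γ} (hf : IsCharacter f) :
    IsCharacter (antipode f) := by
  refine ⟨hf.invariant.antipode hf.one, fun T hT => ?_,
    (hf.isMultiplicative.of_conv_eq_counit hf.one (antipode_conv hf.one)).mul⟩
  rw [antipode_eq_sum hf.one (M := 1) T (by simp [hT]), Finset.sum_range_one]
  exact if_pos hT

end Invariance

/-! ### Dependence on the tagged particle -/

section Untagged

variable {Ω : Type*} {d : ℕ}

lemma LionsForest.sub_h₀_eq_empty {T : LionsForest d} (h : T.h₀ = ∅) (A : Finset ℕ) :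
    (T.sub A).h₀ = ∅ := by
  by_cases hA : T.Convex A
  · rw [sub_h₀ hA, h, Finset.empty_inter]
  · rw [sub_eq_self hA, h]

/-- Nodes of hyperedges lie in blocks of `T.H`, so `spread` never falls back on `ω₀` there. -/
lemma spread_rep_eq_of_snd_eq {T : LionsForest d} {A p : Finset ℕ} (hp : p ∈ (T.sub A).H)
    {ω ω' : Ω × (T.H → Ω)} (h : ω.2 = ω'.2) : spread T.H ω (rep p) = spread T.H ω' (rep p) := by
  obtain ⟨b, _, hb⟩ := T.exists_block A
  have hs := hb ⟨p, hp⟩ (rep_mem ((T.sub A).nonempty_of_mem_H hp))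
  rw [spread_eq T.H_partition ω (b ⟨p, hp⟩).2 hs, spread_eq T.H_partition ω' (b ⟨p, hp⟩).2 hs, h]

variable [MeasurableSpace Ω] {ℙ : Measure Ω} {α β γ : ℝ≥0}

/-- `⟨f, T⟩` does not depend on `ω₀`. -/
def UntaggedAt (f : Family ℙ d α β γ) (T : Trunc d α β γ) : Prop :=
  ∃ Z : (T.1.H → Ω) → (T.1.N → Fin d) → ℝ, Measurable Z ∧
    ∀ᵐ ω ∂prodMeasure ℙ T.1.H, ∀ i, f T ω i = Z ω.2 i

lemma UntaggedAt.sub {f g : Family ℙ d α β γ} {T : Trunc d α β γ} (hf : UntaggedAt f T)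
    (hg : UntaggedAt g T) : UntaggedAt (f - g) T := by
  obtain ⟨Y, hY, h1⟩ := hf
  obtain ⟨Z, hZ, h2⟩ := hg
  refine ⟨Y - Z, hY.sub hZ, ?_⟩
  filter_upwards [h1, h2, AEEqFun.coeFn_sub (f T) (g T)] with ω h1 h2 h3 i
  exact (congrFun h3 i).trans (congrArg₂ (· - ·) (h1 i) (h2 i))

lemma isUntagged_iff {f : Family ℙ d α β γ} :
    IsUntagged f ↔ ∀ T : Trunc d α β γ, T.1.h₀ = ∅ → UntaggedAt f T := by
  refine forall₂_congr fun T _ => ⟨fun ⟨Y, hY⟩ => ⟨Y, Y.measurable, ?_⟩, fun ⟨Z, hZ, h⟩ => ?_⟩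
  · exact hY.mono fun ω h i => congrFun h i
  · refine ⟨AEEqFun.mk Z hZ.aestronglyMeasurable, ?_⟩
    have := Measure.quasiMeasurePreserving_snd (μ := ℙ) (ν := Measure.pi fun _ : T.1.H => ℙ)
    filter_upwards [h, this.ae (AEEqFun.coeFn_mk Z hZ.aestronglyMeasurable)] with ω h1 h2
    rw [h2]
    exact funext h1

lemma IsUntagged.sub {f g : Family ℙ d α β γ} (hf : IsUntagged f) (hg : IsUntagged g) :
    IsUntagged (f - g) :=
  isUntagged_iff.2 fun T hT => (isUntagged_iff.1 hf T hT).sub (isUntagged_iff.1 hg T hT)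

variable [IsProbabilityMeasure ℙ]

lemma UntaggedAt.counit (T : Trunc d α β γ) : UntaggedAt (counit : Family ℙ d α β γ) T :=
  ⟨fun _ _ => if T.1.N = ∅ then 1 else 0, measurable_const,
    Filter.Eventually.of_forall fun ω i => counit_apply T ω i⟩

lemma UntaggedAt.sum {f : ℕ → Family ℙ d α β γ} {T : Trunc d α β γ}
    (hf : ∀ n, UntaggedAt (f n) T) (M : ℕ) {g : Family ℙ d α β γ}
    (hg : g T = ∑ n ∈ Finset.range M, f n T) : UntaggedAt g T := by
  choose Z hZ h using hf
  refine ⟨fun ω i => ∑ n ∈ Finset.range M, Z n ω i, ?_, ?_⟩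
  · exact measurable_pi_lambda _ fun i => Finset.measurable_sum _ fun n _ =>
      (measurable_pi_apply i).comp (hZ n)
  · rw [hg]
    filter_upwards [ae_all_iff.2 h, coeff_sum_ae (Finset.range M) fun n => f n T] with ω h1 h2 i
    exact (h2 i).trans (Finset.sum_congr rfl fun n _ => h1 n i)

lemma IsUntagged.val {f : Family ℙ d α β γ} (hf : IsUntagged f) {T : Trunc d α β γ}
    (hT : T.1.h₀ = ∅) (A : Finset ℕ) :
    ∃ Z : (T.1.H → Ω) → (T.1.N → Fin d) → ℝ, Measurable Z ∧
      ∀ᵐ ω ∂prodMeasure ℙ T.1.H, ∀ i, val f T A ω i = Z ω.2 i := by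
  obtain ⟨Y, hY, h⟩ := isUntagged_iff.1 hf (T.sub A) (LionsForest.sub_h₀_eq_empty hT A)
  -- An arbitrary value for the tagged variable, needed only to write down `restrVar`; the hyperedge
  -- variables do not depend on it.
  obtain ⟨o⟩ := nonempty_of_isProbabilityMeasure ℙ
  refine ⟨fun ω i => Y (restrVar T.1 A (o, ω)).2 (restrLeg T.1 A i), ?_, ?_⟩
  · refine measurable_pi_lambda _ fun i => (measurable_pi_apply _).comp (hY.comp ?_)
    exact measurable_pi_lambda _ fun p =>
      (measurable_spread T.1.H _).comp measurable_prodMk_left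
  · filter_upwards [ae_restrVar T.1 A h] with ω hω i
    refine (hω (restrLeg T.1 A i)).trans ?_
    have e : (restrVar T.1 A ω).2 = (restrVar T.1 A (o, ω.2)).2 :=
      funext fun p => spread_rep_eq_of_snd_eq p.2 rfl
    rw [e]

lemma IsUntagged.conv {f g : Family ℙ d α β γ} (hf : IsUntagged f) (hg : IsUntagged g) :
    IsUntagged (conv f g) := by
  refine isUntagged_iff.2 fun T hT => ?_
  choose Y hY h1 using hf.val hT
  choose Z hZ h2 using hg.val hT
  refine ⟨fun ω i => ∑ R ∈ T.1.ups, Y (T.1.N \ R) ω i * Z R ω i, ?_, ?_⟩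
  · exact measurable_pi_lambda _ fun i => Finset.measurable_sum _ fun R _ =>
      ((measurable_pi_apply i).comp (hY _)).mul ((measurable_pi_apply i).comp (hZ _))
  · filter_upwards [ae_all_iff.2 h1, ae_all_iff.2 h2, conv_ae f g T] with ω h1 h2 h3 i
    rw [h3 i]
    exact Finset.sum_congr rfl fun R _ => by rw [h1, h2]

lemma isUntagged_counit : IsUntagged (counit : Family ℙ d α β γ) :=
  isUntagged_iff.2 fun T _ => UntaggedAt.counit T

lemma IsUntagged.convPow {f : Family ℙ d α β γ} (hf : IsUntagged f) :
    ∀ n, IsUntagged (convPow f n)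
  | 0 => isUntagged_counit
  | n + 1 => (hf.convPow n).conv hf

lemma IsUntagged.antipode {f : Family ℙ d α β γ} (hf : IsUntagged f)
    (h1 : ∀ T : Trunc d α β γ, T.1.N = ∅ → f T = 1) : IsUntagged (antipode f) :=
  isUntagged_iff.2 fun T hT => UntaggedAt.sum
    (fun n => isUntagged_iff.1 ((isUntagged_counit.sub hf).convPow n) T hT) _
    (antipode_eq_sum h1 T (Nat.lt_succ_self _))

end Untagged

/-! ### `𝓔`-invariance -/

section EInvariance

variable {Ω : Type*} {d : ℕ}

lemma LionsForest.h₀_mem_calE {T : LionsForest d} (h : T.h₀.Nonempty) : T.h₀ ∈ T.calE.H :=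
  Finset.mem_erase.2 ⟨h.ne_empty, Finset.mem_insert_self _ _⟩

/-- The variables of `T` in terms of those of `𝓔[T]`. -/
def untag {T : LionsForest d} (h : T.h₀.Nonempty) (ω : Ω × (T.calE.H → Ω)) : Ω × (T.H → Ω) :=
  (ω.2 ⟨T.h₀, LionsForest.h₀_mem_calE h⟩, fun p => ω.2 ⟨p.1, T.mem_primed p.2⟩)

lemma LionsForest.h₀_notMem_H {T : LionsForest d} (h : T.h₀.Nonempty) : T.h₀ ∉ T.H := by
  intro hm
  obtain ⟨x, hx⟩ := h
  exact (Finset.mem_sdiff.1 (T.subset_of_mem_H hm hx)).2 hx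

lemma LionsForest.convex_calE {T : LionsForest d} {A : Finset ℕ} (hA : T.Convex A) :
    T.calE.Convex A := hA

/-- Restriction commutes with `𝓔`: the trace of `h₀` is an ordinary hyperedge on both sides, or is
absent from both when it is empty. Hence cutting `𝓔[T]` amounts to applying `𝓔` to the parts of `T`.
-/
lemma LionsForest.calE_sub {T : LionsForest d} {A : Finset ℕ} (hA : T.Convex A) :
    T.calE.sub A = (T.sub A).calE := by
  have hA' := convex_calE hA
  refine ext_of_label ?_ ?_ ?_ ?_ fun x hx hx' => ?_
  · rw [sub_N hA']
    exact (sub_N hA).symm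
  · rw [sub_E hA']
    exact (sub_E hA).symm
  · rw [sub_h₀ hA']
    exact Finset.empty_inter _
  · rw [sub_H hA']
    change trace (primed T.h₀ T.H) A = primed (T.sub A).h₀ (T.sub A).H
    rw [sub_h₀ hA, sub_H hA]
    ext p
    simp only [primed, mem_trace, Finset.mem_erase, Finset.mem_insert,
      Finset.nonempty_iff_ne_empty]
    constructor
    · rintro ⟨hp, g, ⟨_, rfl | hg⟩, rfl⟩
      · exact ⟨hp, Or.inl rfl⟩
      · exact ⟨hp, Or.inr ⟨hp, g, hg, rfl⟩⟩
    · rintro ⟨hp, rfl | ⟨_, g, hg, rfl⟩⟩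
      · exact ⟨hp, T.h₀, ⟨fun e => hp (by rw [e, Finset.empty_inter]), Or.inl rfl⟩, rfl⟩
      · exact ⟨hp, g, ⟨fun e => hp (by rw [e, Finset.empty_inter]), Or.inr hg⟩, rfl⟩
  · have hxN := T.calE.sub_N_subset A hx
    rw [sub_L hA' hx hxN]
    exact (sub_L hA hx' hxN).symm

lemma LionsForest.calE_eq_self {T : LionsForest d} (h : T.h₀ = ∅) : T.calE = T := by
  refine LionsForest.ext rfl rfl h.symm ?_ HEq.rfl
  change primed T.h₀ T.H = T.H
  rw [h, primed, Finset.erase_insert T.H_partition.empty_notMem]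

lemma spread_untag {T : LionsForest d} (h : T.h₀.Nonempty) (ω : Ω × (T.calE.H → Ω)) {A : Finset ℕ}
    {p : Finset ℕ} (hp : p ∈ (T.sub A).H) :
    spread T.H (untag h ω) (rep p) = spread T.calE.H ω (rep p) := by
  obtain ⟨b, _, hb⟩ := T.exists_block A
  have hs := hb ⟨p, hp⟩ (rep_mem ((T.sub A).nonempty_of_mem_H hp))
  rw [spread_eq T.H_partition _ (b ⟨p, hp⟩).2 hs,
    spread_eq T.calE.H_partition ω (T.mem_primed (b ⟨p, hp⟩).2) hs]
  rfl

variable [MeasurableSpace Ω] {ℙ : Measure Ω} {α β γ : ℝ≥0} [IsProbabilityMeasure ℙ]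

/-- The variable of `h₀` takes the role of the tagged one, and the `ω₀` of `𝓔[T]` is discarded. As
`h₀` is not among the hyperedges of `T`, the selected variables are distinct and the law is
preserved. -/
lemma isComparison_calE {T : LionsForest d} (h : T.h₀.Nonempty) :
    IsComparison ℙ (Equiv.refl ℕ) T T.calE (untag h) := by
  refine ⟨Finset.image_id.symm, ?_, ?_⟩
  · exact (Finset.image_id (s := T.E)).symm
  · have hφ : Function.Injective fun o : Option T.H => o.elim
        (some (⟨T.h₀, LionsForest.h₀_mem_calE h⟩ : T.calE.H))
        fun p => some (⟨p.1, T.mem_primed p.2⟩ : T.calE.H) := by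
      rintro (_ | ⟨p, hp⟩) (_ | ⟨p', hp'⟩) hpp
      · rfl
      · have : T.h₀ = p' := congrArg Subtype.val (Option.some.inj hpp)
        exact absurd (this ▸ hp') (LionsForest.h₀_notMem_H h)
      · have : p = T.h₀ := congrArg Subtype.val (Option.some.inj hpp)
        exact absurd (this ▸ hp) (LionsForest.h₀_notMem_H h)
      · have : p = p' := congrArg Subtype.val (Option.some.inj hpp)
        subst this
        rfl
    exact (measurePreserving_reindex (ℙ := ℙ) _ hφ).quasiMeasurePreserving.tendsto_ae

/-- The image under `𝓔` in the truncated set. -/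
abbrev Trunc.calE (T : Trunc d α β γ) (hE : T.1.calE.grade α β ≤ γ) : Trunc d α β γ :=
  ⟨T.1.calE, hE⟩

lemma isEInvariant_iff {f : Family ℙ d α β γ} : IsEInvariant f ↔
    ∀ (T : Trunc d α β γ) (hE : T.1.calE.grade α β ≤ γ) (h : T.1.h₀.Nonempty),
      (isComparison_calE (ℙ := ℙ) h).Agrees (T' := T.calE hE) f := by
  refine forall₃_congr fun T hE h => Filter.eventually_congr (Filter.Eventually.of_forall
    fun ω => ?_)
  exact ⟨fun e i => (congrFun e i).symm, fun e => funext fun i => (e i).symm⟩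

/-- If `A` meets `h₀`, the induced forest is still tagged and `𝓔`-invariance applies to it. If `A`
misses `h₀`, `𝓔`-invariance says nothing, and independence of the tagged variable has to fill the
gap. -/
lemma IsEInvariant.agreesOnSub {f : Family ℙ d α β γ} (hf : IsEInvariant f) (hu : IsUntagged f)
    (T : Trunc d α β γ) (hE : T.1.calE.grade α β ≤ γ) (h : T.1.h₀.Nonempty) :
    (isComparison_calE (ℙ := ℙ) h).AgreesOnSub (T' := T.calE hE) f := by
  intro A hA
  have hA' := LionsForest.convex_calE hA
  have hcal : ((T.calE hE).sub A).1 = (T.sub A).1.calE := LionsForest.calE_sub hA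
  have hES : (T.sub A).1.calE.grade α β ≤ γ := hcal ▸ ((T.calE hE).sub A).2
  have key : ∀ᵐ ω ∂prodMeasure ℙ T.1.calE.H, ∀ i : T.1.N → Fin d,
      f ((T.sub A).calE hES) (ω.1, fun p => spread T.1.calE.H ω (rep p.1))
        (fun x => i ⟨x.1, T.1.sub_N_subset A x.2⟩) = val f T A (untag h ω) i := by
    by_cases h0 : (T.sub A).1.h₀.Nonempty
    · obtain ⟨b, hb, hs⟩ : ∃ b : (T.1.sub A).calE.H → T.1.calE.H,
          Function.Injective b ∧ ∀ p, p.1 ⊆ (b p).1 := by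
        have := T.1.calE.exists_block A
        rwa [LionsForest.calE_sub hA] at this
      have hr := fun p => hs p (rep_mem ((T.1.sub A).calE.nonempty_of_mem_H p.2))
      filter_upwards [ae_reindex T.1.calE.H_partition none b hb (fun _ => by simp)
        (fun p => rep p.1) hr (hf (T.sub A) hES h0)] with ω hω i
      refine (congrFun hω fun x => i ⟨x.1, T.1.sub_N_subset A x.2⟩).symm.trans ?_
      have e1 : spread T.1.calE.H ω (rep (T.1.sub A).h₀) = (untag h ω).1 := by
        have := rep_mem h0
        have hsub : (T.1.sub A).h₀ ⊆ T.1.h₀ := by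
          rw [LionsForest.sub_h₀ hA]
          exact Finset.inter_subset_left
        exact spread_eq T.1.calE.H_partition ω (LionsForest.h₀_mem_calE h) (hsub this)
      have e2 : (fun p : (T.1.sub A).H => spread T.1.calE.H ω (rep p.1)) =
          fun p => spread T.1.H (untag h ω) (rep p.1) :=
        funext fun p => (spread_untag h ω p.2).symm
      exact congrArg (fun v => f (T.sub A) v fun x => i ⟨x.1, T.1.sub_N_subset A x.2⟩)
        (Prod.ext e1 e2)
    -- Here `𝓔` fixes the induced forest, but the left side uses `ω₀` and the right side `ω_{h₀}` as
    -- tagged variable. A version `Y` without that variable is pulled back along both samplings.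
    · rw [Finset.not_nonempty_iff_eq_empty] at h0
      obtain ⟨Y, _, hY⟩ := isUntagged_iff.1 hu (T.sub A) h0
      obtain ⟨b, hb, hs⟩ := T.1.exists_block A
      have hr := fun p => hs p (rep_mem ((T.1.sub A).nonempty_of_mem_H p.2))
      have e0 : (T.sub A).calE hES = T.sub A := Subtype.ext (LionsForest.calE_eq_self h0)
      filter_upwards [ae_reindex T.1.calE.H_partition none
        (fun p => (⟨(b p).1, T.1.mem_primed (b p).2⟩ : T.1.calE.H))
        (fun p p' hpp => hb (Subtype.ext (Subtype.mk.inj hpp))) (fun _ => by simp)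
        (fun p => rep p.1) hr hY,
        (isComparison_calE (ℙ := ℙ) h).tendsto.eventually (ae_restrVar T.1 A hY)]
        with ω h1 h2 i
      refine (eval_congr f e0 (K := T.1.N) (T.1.sub_N_subset A) (T.1.sub_N_subset A) ω.1 _
        (spread T.1.calE.H ω) (fun _ _ => rfl) i).trans ?_
      refine (h1 _).trans (Eq.trans ?_ (h2 (restrLeg T.1 A i)).symm)
      have e2 : (fun p : (T.1.sub A).H => spread T.1.calE.H ω (rep p.1)) =
          fun p => spread T.1.H (untag h ω) (rep p.1) :=
        funext fun p => (spread_untag h ω p.2).symm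
      exact congrArg (fun v => Y v (restrLeg T.1 A i)) e2
  filter_upwards [key] with ω hω i
  rw [show A.image (Equiv.refl ℕ) = A from Finset.image_id]
  refine Eq.trans ?_ (hω i)
  exact eval_congr f (Subtype.ext hcal) (K := T.1.N) (T.1.calE.sub_N_subset A)
    (T.1.sub_N_subset A) ω.1 _ _ (fun _ _ => rfl) i

lemma isEInvariant_counit : IsEInvariant (counit : Family ℙ d α β γ) :=
  isEInvariant_iff.2 fun _ _ _ => IsComparison.agrees_counit _

lemma IsEInvariant.sub {f g : Family ℙ d α β γ} (hf : IsEInvariant f) (hg : IsEInvariant g) :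
    IsEInvariant (f - g) :=
  isEInvariant_iff.2 fun T hE h => IsComparison.agrees_sub _
    (isEInvariant_iff.1 hf T hE h) (isEInvariant_iff.1 hg T hE h)

lemma IsEInvariant.conv {f g : Family ℙ d α β γ} (hf : IsEInvariant f) (hf' : IsUntagged f)
    (hg : IsEInvariant g) (hg' : IsUntagged g) : IsEInvariant (conv f g) :=
  isEInvariant_iff.2 fun T hE h => IsComparison.agrees_conv _
    (hf.agreesOnSub hf' T hE h) (hg.agreesOnSub hg' T hE h)

lemma IsEInvariant.convPow {f : Family ℙ d α β γ} (hf : IsEInvariant f) (hf' : IsUntagged f) :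
    ∀ n, IsEInvariant (convPow f n)
  | 0 => isEInvariant_counit
  | n + 1 => (hf.convPow hf' n).conv (hf'.convPow n) hf hf'

lemma IsEInvariant.antipode {f : Family ℙ d α β γ} (hf : IsEInvariant f) (hf' : IsUntagged f)
    (h1 : ∀ T : Trunc d α β γ, T.1.N = ∅ → f T = 1) : IsEInvariant (antipode f) :=
  isEInvariant_iff.2 fun T hE h => IsComparison.agrees_antipode _ h1 fun n =>
    isEInvariant_iff.1 ((isEInvariant_counit.sub hf).convPow (isUntagged_counit.sub hf') n) T hE h

end EInvariance

/-! ### Tagging a hyperedge -/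

section Retag

variable {d : ℕ} {T : LionsForest d}

lemma primed_erase {H : Finset (Finset ℕ)} {h : Finset ℕ} (h0 : ∅ ∉ H) (hh : h ∈ H) :
    primed h (H.erase h) = H := by
  rw [primed, Finset.insert_erase hh, Finset.erase_eq_of_notMem h0]

/-- The forest in which the hyperedge `h` of a root is made the `0`-hyperedge. -/
def LionsForest.retag (T : LionsForest d) (h0 : T.h₀ = ∅) (h : Finset ℕ) (hh : h ∈ T.H)
    (hroot : ∃ x ∈ h, ∀ y ∈ T.N, depth T.E x ≤ depth T.E y) : LionsForest d where
  N := T.N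
  E := T.E
  h₀ := h
  H := T.H.erase h
  L := T.L
  E_subset := T.E_subset
  E_functional := T.E_functional
  E_acyclic := T.E_acyclic
  h₀_subset := (T.subset_of_mem_H hh).trans Finset.sdiff_subset
  H_partition := by
    have hp := T.H_partition
    rw [h0, Finset.sdiff_empty] at hp
    refine ⟨fun he => hp.empty_notMem (Finset.mem_of_mem_erase he), fun g hg g' hg' =>
      hp.disjoint g (Finset.mem_of_mem_erase hg) g' (Finset.mem_of_mem_erase hg'), fun x => ?_⟩
    rw [Finset.mem_sdiff, hp.cover x]
    constructor
    · rintro ⟨⟨g, hg, hx⟩, hxh⟩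
      exact ⟨g, Finset.mem_erase.2 ⟨fun e => hxh (e ▸ hx), hg⟩, hx⟩
    · rintro ⟨g, hg, hx⟩
      rw [Finset.mem_erase] at hg
      exact ⟨⟨g, hg.2, hx⟩, fun hxh => hg.1 (hp.eq_of_mem hg.2 hh hx hxh)⟩
  h₀_root := fun _ => hroot
  parent_mem := by
    rw [primed_erase T.H_partition.empty_notMem hh]
    exact fun g hg => T.parent_mem g (T.mem_primed hg)
  parents_mem := by
    rw [primed_erase T.H_partition.empty_notMem hh]
    exact fun g hg => T.parents_mem g (T.mem_primed hg)

lemma LionsForest.calE_retag (h0 : T.h₀ = ∅) {h : Finset ℕ} (hh : h ∈ T.H)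
    (hroot : ∃ x ∈ h, ∀ y ∈ T.N, depth T.E x ≤ depth T.E y) :
    (T.retag h0 h hh hroot).calE = T :=
  LionsForest.ext rfl rfl h0.symm (primed_erase T.H_partition.empty_notMem hh) HEq.rfl

/-- Tagging `h` changes the weight of each of its nodes from `β` to `α`; this is where `α ≤ β`
enters. -/
lemma LionsForest.grade_retag_le {α β : ℝ≥0} (hαβ : α ≤ β) (h0 : T.h₀ = ∅) {h : Finset ℕ}
    (hh : h ∈ T.H) (hroot : ∃ x ∈ h, ∀ y ∈ T.N, depth T.E x ≤ depth T.E y) :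
    (T.retag h0 h hh hroot).grade α β ≤ T.grade α β := by
  have hs : h ⊆ T.N := (T.subset_of_mem_H hh).trans Finset.sdiff_subset
  have hc : (h.card : ℝ≥0) + (T.N \ h).card = T.N.card := by
    rw [add_comm]
    exact_mod_cast Finset.card_sdiff_add_card_eq_card hs
  simp only [grade, h0, Finset.card_empty, Nat.cast_zero, mul_zero, zero_add, Finset.sdiff_empty]
  change α * (h.card : ℝ≥0) + β * (T.N \ h).card ≤ _
  rw [← hc, mul_add]
  gcongr

variable {Ω : Type*} [MeasurableSpace Ω] {ℙ : Measure Ω} {α β γ : ℝ≥0} [IsProbabilityMeasure ℙ]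

/-- If tagging costs nothing, then the coefficients of untagged forests are determined by those of
tagged ones, and hence do not depend on `ω₀`. -/
lemma IsEInvariant.isUntagged {f : Family ℙ d α β γ} (hαβ : α ≤ β) (hf : IsEInvariant f)
    (h1 : ∀ T : Trunc d α β γ, T.1.N = ∅ → f T = 1) : IsUntagged f := by
  -- The coefficient of the tagged forest `R`, evaluated with `ω_{h₀}` in its tagged slot, involves
  -- hyperedge variables only, and `𝓔`-invariance equates it with the coefficient of `T`.
  have aux : ∀ T R : Trunc d α β γ, R.1.calE = T.1 → R.1.h₀.Nonempty → UntaggedAt f T := by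
    rintro ⟨_, hT⟩ R rfl h
    refine ⟨fun ω => f R (ω ⟨R.1.h₀, LionsForest.h₀_mem_calE h⟩,
      fun p => ω ⟨p.1, R.1.mem_primed p.2⟩), ?_, ?_⟩
    · exact (f R).measurable.comp (by fun_prop)
    · filter_upwards [hf R hT h] with ω hω i
      exact (congrFun hω i).symm
  refine isUntagged_iff.2 fun T h0 => ?_
  rcases T.1.N.eq_empty_or_nonempty with hN | hN
  -- The empty forest has no hyperedge to tag; its coefficient is constant by normalisation.
  · rw [UntaggedAt, h1 T hN]
    exact ⟨fun _ _ => 1, measurable_const,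
      Filter.Eventually.of_forall fun ω i => coeff_one_apply ω i⟩
  -- A `0`-hyperedge must contain a node of minimal depth, so the block of such a node is the one to
  -- tag.
  · obtain ⟨x, hx, hmin⟩ := Finset.exists_min_image T.1.N (depth T.1.E) hN
    obtain ⟨h, hh, hxh⟩ := (T.1.H_partition.cover x).1 (by rwa [h0, Finset.sdiff_empty])
    have hroot : ∃ x ∈ h, ∀ y ∈ T.1.N, depth T.1.E x ≤ depth T.1.E y := ⟨x, hxh, hmin⟩
    exact aux T ⟨T.1.retag h0 h hh hroot,
      (LionsForest.grade_retag_le hαβ h0 hh hroot).trans T.2⟩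
      (LionsForest.calE_retag h0 hh hroot) ⟨x, hxh⟩

end Retag

/-! ### The group of characters -/

section Group

variable {Ω : Type*} [MeasurableSpace Ω] (ℙ : Measure Ω) [IsProbabilityMeasure ℙ] (d : ℕ)
  (α β γ : ℝ≥0)

/-- The characters form a group under convolution. -/
abbrev characterGroup : Group (Character ℙ d α β γ) :=
  letI : Mul (Character ℙ d α β γ) := ⟨fun f g => ⟨conv f.1 g.1, f.2.conv g.2⟩⟩
  letI : One (Character ℙ d α β γ) := ⟨⟨counit, isCharacter_counit⟩⟩
  letI : Inv (Character ℙ d α β γ) := ⟨fun f => ⟨antipode f.1, f.2.antipode⟩⟩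
  -- Left unit and left inverse suffice for a group, so the right-hand identities for `ε` and the
  -- antipode need no separate proof.
  Group.ofLeftAxioms (fun f g h => Subtype.ext (conv_assoc f.1 g.1 h.1))
    (fun f => Subtype.ext (counit_conv f.1)) fun f => Subtype.ext (antipode_conv f.2.one)

/-- The subgroup of McKean–Vlasov characters. -/
def mcKeanVlasovSubgroup :
    letI := characterGroup ℙ d α β γ
    Subgroup (Character ℙ d α β γ) :=
  letI := characterGroup ℙ d α β γ
  { carrier := {f | IsMcKeanVlasov f}
    mul_mem' := fun hf hg => ⟨hf.1.conv hf.2 hg.1 hg.2, hf.2.conv hg.2⟩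
    one_mem' := ⟨isEInvariant_counit, isUntagged_counit⟩
    inv_mem' := fun {f} hf => ⟨hf.1.antipode hf.2 f.2.one, hf.2.antipode f.2.one⟩ }

end Group

end Lions

end

theorem mainTheorem5 {Ω : Type*} [MeasurableSpace Ω] (ℙ : MeasureTheory.Measure Ω)
    [MeasureTheory.IsProbabilityMeasure ℙ] (d : ℕ) (α β γ : NNReal) (hα : 0 < α) (hβ : 0 < β)
    (hγ : min α β ≤ γ) :
    (∃ grp : Group (Lions.Character ℙ d α β γ),
      (∀ f g : Lions.Character ℙ d α β γ, (grp.mul f g).1 = Lions.conv f.1 g.1) ∧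
      (grp.one).1 = Lions.counit ∧
      (∀ f : Lions.Character ℙ d α β γ, (grp.inv f).1 = Lions.antipode f.1) ∧
      ∃ G : Subgroup (Lions.Character ℙ d α β γ),
        (G : Set (Lions.Character ℙ d α β γ)) = {f | Lions.IsMcKeanVlasov f}) ∧
    (α ≤ β → ∀ f : Lions.Character ℙ d α β γ,
      Lions.IsMcKeanVlasov f ↔ Lions.IsEInvariant f.1) :=
  ⟨⟨Lions.characterGroup ℙ d α β γ, fun _ _ => rfl, rfl, fun _ => rfl,
    Lions.mcKeanVlasovSubgroup ℙ d α β γ, rfl⟩,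
    fun hαβ f => ⟨fun h => h.1, fun h => ⟨h, h.isUntagged hαβ f.2.one⟩⟩⟩
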